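/- **Topological recursion.** Consider a rational spectral curve, i.e. functions $x,y$ of the affine coordinate $z$ on $\mathbb{CP}^1$ together with $B(z_1,z_2)=\frac{dz_1\,dz_2}{(z_1-z_2)^2}$, such that $dx$ has only simple zeros $\alpha$ (the branch points, all finite) and $y$ is holomorphic near them. Let $\sigma_\alpha$ be the non-trivial local holomorphic involution at $\alpha$ with $x\circ\sigma_\alpha=x$. Put $\omega_{0,1}=y\,dx$, $\omega_{0,2}=B$, $$K_\alpha(z_1,z)=\frac12\,\frac{\int_z^{\sigma_\alpha(z)}\omega_{0,2}(z_1,\cdot)}{\omega_{0,1}(z)-\omega_{0,1}(\sigma_\alpha(z))},$$ and, for $g\ge 0$, $n\ge 1$, $2g-2+n>0$ and $S=\{2,\dots,n\}$, $$\omega_{g,n}(z_1,z_S)=\sum_\alpha \operatorname*{Res}_{z=\alpha} K_\alpha(z_1,z)\Big[\omega_{g-1,n+1}(z,\sigma_\alpha(z),z_S)+\sum^{\circ}_{\substack{g_1+g_2=g\\ I\sqcup J=S}}\omega_{g_1,|I|+1}(z,z_I)\,\omega_{g_2,|J|+1}(\sigma_\alpha(z),z_J)\Big],$$ where $\omega_{-1,n+1}=0$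 and $\circ$ means that terms containing $\omega_{0,1}$ are omitted. **The curves.** For $0<q<1$ let $\omega_{g,n}$ be the differentials produced by Okuyama's curve $$x(z)=z+z^{-1},\qquad y(z)=\tfrac12(z-z^{-1})\prod_{k=1}^{\infty}\frac{(1-q^kz^2)(1-q^kz^{-2})}{(1-q^k)^2},$$ and $\omega^{M}_{g,n}$ those produced by the same $x$ and the rational function $y^M$ obtained by truncating the product to $1\le k\le M$. Let $\omega^{\mathrm{WP}}_{g,n}$ be those produced by $x(t)=\frac{t^2}{2}$, $y(t)=\frac{\sin(2\pi t)}{2\pi}$, and $\omega^{\mathrm{WP},M}_{g,n}$ those produced by the same $x$ and $y^M(t)=\sum_{k=0}^M\frac{(-1)^k(2\pi)^{2k}}{(2k+1)!}t^{2k+1}$. **Proposition.** Let $g\ge0$, $n\ge1$ with $2g-2+n>0$. 1. (Meaning of $\omega_{g,n}$.) For every $q\in(0,1)$ and all $z_1,\dots,z_n\in\mathbb C\setminus\{1,-1\}$, $\omega^M_{g,n}(z_1,\dots,z_n)\to\omega_{g,n}(z_1,\dots,z_n)$ as $M\to\infty$. 2. (Meaning of $\omega^{\mathrm{WP}}_{g,n}$.)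 For all sufficiently large $M$, $\omega^{\mathrm{WP},M}_{g,n}=\omega^{\mathrm{WP}}_{g,n}$ on $(\mathbb C\setminus\{0\})^n$. 3. Set $q=e^{-\lambda}$ with $\lambda>0$ and substitute $z_i=\lambda t_i+1$ (so that $dz_i=\lambda\,dt_i$). Then, as multidifferentials in $t_1,\dots,t_n\in\mathbb C\setminus\{0\}$, $$\lim_{\lambda\to0^+}\lambda^{6g-6+3n}\,\omega_{g,n}(z_1,\dots,z_n)=2^{2-2g-n}\,\omega^{\mathrm{WP}}_{g,n}(t_1,\dots,t_n),$$ the coefficients of $dt_1\cdots dt_n$ converging locally uniformly (in particular pointwise) on $(\mathbb C\setminus\{0\})^n$. -/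

import Mathlib

open Filter Topology Real

noncomputable section

/-- The residue at `α` of the meromorphic 1-form `f(z) dz`: the value of `(2πi)⁻¹ ∮ f(z) dz` over all
sufficiently small positively oriented circles around `α`. -/
def residueAt (f : ℂ → ℂ) (α : ℂ) : ℂ :=
  limUnder (𝓝[>] (0 : ℝ)) fun r : ℝ => (2 * (π : ℂ) * Complex.I)⁻¹ * ∮ z in C(α, r), f z

/-- The points of the affine chart `ℂ` at which `x` is holomorphic and `dx = 0`. -/
def branchPoints (x : ℂ → ℂ) : Set ℂ := {α | HasDerivAt x 0 α}

/-- A rational spectral curve, written in the affine coordinate `z` of `ℂℙ¹` and with bidifferential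
`dz₁ dz₂ / (z₁ - z₂)²`. All branch points are assumed to lie in the affine chart, and `dx` vanishes to
order exactly one at each of them. `σ α` is the local holomorphic involution at the branch point `α`:
the germ at `α` of a holomorphic map that fixes `α`, is not the identity, and satisfies `x ∘ σ α = x`
(these conditions determine the germ). Only the germs of `y` at the branch points matter for the
correlation differentials, so `y` is not required to be rational. -/
structure RationalSpectralCurve where
  x : ℂ → ℂ
  y : ℂ → ℂ
  σ : ℂ → ℂ → ℂ
  finite_branchPoints : (branchPoints x).Finite
  analyticAt_x : ∀ α ∈ branchPoints x, AnalyticAt ℂ x α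
  simple_branching : ∀ α ∈ branchPoints x, deriv (deriv x) α ≠ 0
  analyticAt_σ : ∀ α ∈ branchPoints x, AnalyticAt ℂ (σ α) α
  σ_fixed : ∀ α ∈ branchPoints x, σ α α = α
  σ_nontrivial : ∀ α ∈ branchPoints x, ∀ᶠ z in 𝓝[≠] α, σ α z ≠ z
  x_comp_σ : ∀ α ∈ branchPoints x, ∀ᶠ z in 𝓝 α, x (σ α z) = x z

namespace RationalSpectralCurve

variable (C : RationalSpectralCurve)

/-- The coefficient of `ω₀₁ = y dx` with respect to `dz`. -/
def omega01 (z : ℂ) : ℂ := C.y z * deriv C.x z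

/-- The coefficient of `ω₀₂ = dz₁ dz₂ / (z₁ - z₂)²` with respect to `dz₁ dz₂`. -/
def omega02 (z₁ z₂ : ℂ) : ℂ := 1 / (z₁ - z₂) ^ 2

/-- The recursion kernel
`K_α(z₁, z) = (1/2) (∫_z^{σ_α(z)} ω₀₂(z₁, ·)) / (ω₀₁(z) - ω₀₁(σ_α(z)))`, as the coefficient of
`dz₁ / dz`. The integral is along the straight segment from `z` to `σ_α(z)`, and `ω₀₁(σ_α(z))` is the
pullback of `ω₀₁` under `σ_α`. -/
def kernel (α z₁ z : ℂ) : ℂ :=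
  (1 / 2) *
    (∫ s in (0 : ℝ)..1, omega02 z₁ (z + (s : ℂ) * (C.σ α z - z)) * (C.σ α z - z)) /
    (C.omega01 z - C.omega01 (C.σ α z) * deriv (C.σ α) z)

/-- `C.corr g n z` is the coefficient `W` in `ω_{g,n}(z₁, …, zₙ) = W(z₁, …, zₙ) dz₁ ⋯ dzₙ`, where the
`ω_{g,n}` are the correlation differentials of topological recursion (`n ≥ 1`; the value for `n = 0`
is a placeholder). In the last clause `z 0` is the distinguished variable, `S` is indexed by `Fin m`
through `i ↦ z i.succ`, the sum over `I` is the sum over all `I ⊔ J = S` with `J = Iᶜ`, the terms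
containing `ω₀₁` are omitted, and the factor `deriv (C.σ α) p` comes from pulling back
a differential under `σ_α`. -/
def corr : (g n : ℕ) → (Fin n → ℂ) → ℂ
  | _, 0, _ => 0
  | 0, 1, z => C.omega01 (z 0)
  | 0, 2, z => omega02 (z 0) (z 1)
  | g, m + 1, z =>
    ∑ᶠ α ∈ branchPoints C.x, residueAt (fun p : ℂ =>
      C.kernel α (z 0) p * deriv (C.σ α) p *
        ((if _h : 0 < g then
            corr (g - 1) (m + 2)
              (Fin.cons p (Fin.cons (C.σ α p) fun i : Fin m => z i.succ))
          else 0) +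
        ∑ g₁ : Fin (g + 1), ∑ I : Finset (Fin m),
          if _h : ¬ (g₁.val = 0 ∧ I.card = 0) ∧ ¬ (g - g₁.val = 0 ∧ Iᶜ.card = 0) then
            corr g₁.val (I.card + 1)
              (Fin.cons p fun i => z (I.orderEmbOfFin rfl i).succ) *
            corr (g - g₁.val) (Iᶜ.card + 1)
              (Fin.cons (C.σ α p) fun i => z (Iᶜ.orderEmbOfFin rfl i).succ)
          else 0)) α
termination_by g n => 2 * g + n
decreasing_by
  · omega
  · have h1 := I.card_add_card_compl
    rw [Fintype.card_fin] at h1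
    have h2 := g₁.isLt
    omega
  · have h1 := I.card_add_card_compl
    rw [Fintype.card_fin] at h1
    have h2 := g₁.isLt
    omega

end RationalSpectralCurve

/-- The coefficient with respect to `dt₁ ⋯ dtₙ` of the multidifferential obtained from
`W(z₁, …, zₙ) dz₁ ⋯ dzₙ` by the substitution `zᵢ = φ(tᵢ)`. -/
def pullbackCoeff (φ : ℂ → ℂ) {n : ℕ} (W : (Fin n → ℂ) → ℂ) (t : Fin n → ℂ) : ℂ :=
  W (fun i => φ (t i)) * ∏ i, deriv φ (t i)

theorem hasDerivAt_joukowsky {z : ℂ} (hz : z ≠ 0) :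
    HasDerivAt (fun z : ℂ => z + z⁻¹) (1 - (z ^ 2)⁻¹) z := by
  rw [sub_eq_add_neg]
  exact (hasDerivAt_id' z).add (hasDerivAt_inv hz)

theorem branchPoints_joukowsky : branchPoints (fun z : ℂ => z + z⁻¹) = {1, -1} := by
  ext α
  simp only [branchPoints, Set.mem_ofPred_eq, Set.mem_insert_iff, Set.mem_singleton_iff]
  constructor
  · intro h
    by_cases h0 : α = 0
    · subst h0
      exfalso
      have h1 : HasDerivAt (fun z : ℂ => z⁻¹) (0 - 1) 0 := by
        have := h.sub (hasDerivAt_id (0 : ℂ))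
        refine this.congr_of_eventuallyEq (Eventually.of_forall fun z => ?_)
        simp
      exact (differentiableAt_inv_iff.1 h1.differentiableAt) rfl
    · have h1 := (hasDerivAt_joukowsky h0).unique h
      have h2 : α ^ 2 = 1 := by
        have : (α ^ 2)⁻¹ = 1 := by linear_combination -h1
        simpa using this
      exact sq_eq_one_iff.1 h2
  · rintro (rfl | rfl)
    · simpa using hasDerivAt_joukowsky (one_ne_zero)
    · simpa using hasDerivAt_joukowsky (z := -1) (by norm_num)

/-- The rational spectral curve with `x(z) = z + z⁻¹` and a given `y`; its branch points are `1` and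
`-1`, and both local involutions are `z ↦ z⁻¹`. -/
def joukowskyCurve (y : ℂ → ℂ) : RationalSpectralCurve where
  x := fun z => z + z⁻¹
  y := y
  σ := fun _ z => z⁻¹
  finite_branchPoints := by rw [branchPoints_joukowsky]; simp
  analyticAt_x := by
    rw [branchPoints_joukowsky]
    rintro α (rfl | rfl) <;> exact analyticAt_id.add (analyticAt_inv (by norm_num))
  simple_branching := by
    have key : ∀ α : ℂ, α ≠ 0 → deriv (deriv fun z : ℂ => z + z⁻¹) α = 2 * α / (α ^ 2) ^ 2 := by
      intro α hα
      have h1 : deriv (fun z : ℂ => z + z⁻¹) =ᶠ[𝓝 α] fun z => 1 - (z ^ 2)⁻¹ := by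
        filter_upwards [isOpen_ne.mem_nhds hα] with z hz
        exact (hasDerivAt_joukowsky hz).deriv
      rw [h1.deriv_eq]
      have h2 := ((hasDerivAt_pow 2 α).inv (pow_ne_zero 2 hα)).const_sub 1
      rw [show (fun z : ℂ => 1 - (z ^ 2)⁻¹) = (fun z : ℂ => 1 - ((fun w => w ^ 2)⁻¹ : ℂ → ℂ) z)
        from rfl, h2.deriv]
      simp [neg_div]
    rw [branchPoints_joukowsky]
    rintro α (rfl | rfl) <;> rw [key _ (by norm_num)] <;> norm_num
  analyticAt_σ := by
    rw [branchPoints_joukowsky]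
    rintro α (rfl | rfl) <;> exact analyticAt_inv (by norm_num)
  σ_fixed := by
    rw [branchPoints_joukowsky]
    rintro α (rfl | rfl) <;> norm_num
  σ_nontrivial := by
    have key : ∀ α β : ℂ, α ≠ 0 → α ≠ β → (∀ z : ℂ, z ^ 2 = 1 → z = α ∨ z = β) →
        ∀ᶠ z in 𝓝[≠] α, z⁻¹ ≠ z := by
      intro α β h0 hαβ h
      filter_upwards [self_mem_nhdsWithin, mem_nhdsWithin_of_mem_nhds (isOpen_ne.mem_nhds hαβ),
        mem_nhdsWithin_of_mem_nhds (isOpen_ne.mem_nhds h0)] with z h1 h2 h3 h4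
      have h5 : z ^ 2 = 1 := by
        rw [sq]; nth_rewrite 1 [← h4]; exact inv_mul_cancel₀ h3
      rcases h z h5 with h6 | h6
      · exact h1 h6
      · exact h2 h6
    rw [branchPoints_joukowsky]
    rintro α (rfl | rfl)
    · exact key 1 (-1) (by norm_num) (by norm_num) fun z hz => sq_eq_one_iff.1 hz
    · exact key (-1) 1 (by norm_num) (by norm_num) fun z hz => (sq_eq_one_iff.1 hz).symm
  x_comp_σ := by
    intro α _
    exact Eventually.of_forall fun z => by simp [add_comm]

theorem branchPoints_half_sq : branchPoints (fun t : ℂ => t ^ 2 / 2) = {0} := by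
  have h : ∀ t : ℂ, HasDerivAt (fun t : ℂ => t ^ 2 / 2) t t := fun t => by
    simpa using (hasDerivAt_pow 2 t).div_const 2
  ext α
  simp only [branchPoints, Set.mem_ofPred_eq, Set.mem_singleton_iff]
  refine ⟨fun h0 => (h α).unique h0, ?_⟩
  rintro rfl
  exact h 0

/-- The rational spectral curve with `x(t) = t² / 2` and a given `y`; its only branch point is `0`
(`dx` has a pole at infinity), with local involution `t ↦ -t`. -/
def halfSquareCurve (y : ℂ → ℂ) : RationalSpectralCurve where
  x := fun t => t ^ 2 / 2
  y := y
  σ := fun _ t => -t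
  finite_branchPoints := by rw [branchPoints_half_sq]; simp
  analyticAt_x := fun α _ => by fun_prop
  simple_branching := fun α _ => by
    have h : deriv (fun t : ℂ => t ^ 2 / 2) = fun t => t := by
      ext t
      simp
    rw [h]
    simp
  analyticAt_σ := fun α _ => by fun_prop
  σ_fixed := by rw [branchPoints_half_sq]; simp
  σ_nontrivial := by
    rw [branchPoints_half_sq]
    rintro α rfl
    filter_upwards [self_mem_nhdsWithin] with t ht h
    exact ht (self_eq_neg.1 h.symm)
  x_comp_σ := fun α _ => Eventually.of_forall fun t => by simp

/-- `y(z) = (1/2) (z - z⁻¹) ∏_{k ≥ 1} (1 - qᵏ z²) (1 - qᵏ z⁻²) / (1 - qᵏ)²`. -/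
def okuyamaY (q : ℝ) (z : ℂ) : ℂ :=
  (1 / 2) * (z - z⁻¹) *
    ∏' k : ℕ, (1 - (q : ℂ) ^ (k + 1) * z ^ 2) * (1 - (q : ℂ) ^ (k + 1) * (z ^ 2)⁻¹) /
      (1 - (q : ℂ) ^ (k + 1)) ^ 2

/-- The rational function obtained from `okuyamaY` by truncating the product to `1 ≤ k ≤ M`. -/
def okuyamaYTrunc (q : ℝ) (M : ℕ) (z : ℂ) : ℂ :=
  (1 / 2) * (z - z⁻¹) *
    ∏ k ∈ Finset.range M, (1 - (q : ℂ) ^ (k + 1) * z ^ 2) * (1 - (q : ℂ) ^ (k + 1) * (z ^ 2)⁻¹) /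
      (1 - (q : ℂ) ^ (k + 1)) ^ 2

/-- Okuyama's spectral curve. -/
def okuyamaCurve (q : ℝ) : RationalSpectralCurve := joukowskyCurve (okuyamaY q)

/-- Okuyama's spectral curve with the product in `y` truncated after `M` factors. -/
def okuyamaCurveTrunc (q : ℝ) (M : ℕ) : RationalSpectralCurve := joukowskyCurve (okuyamaYTrunc q M)

/-- The Weil–Petersson spectral curve `x(t) = t² / 2`, `y(t) = sin(2πt) / (2π)`. -/
def wpCurve : RationalSpectralCurve :=
  halfSquareCurve fun t => Complex.sin (2 * (π : ℂ) * t) / (2 * (π : ℂ))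

/-- The Weil–Petersson spectral curve with `y` replaced by its Taylor polynomial
`∑_{k ≤ M} (-1)ᵏ (2π)²ᵏ t²ᵏ⁺¹ / (2k+1)!`. -/
def wpCurveTrunc (M : ℕ) : RationalSpectralCurve :=
  halfSquareCurve fun t =>
    ∑ k ∈ Finset.range (M + 1),
      (-1) ^ k * (2 * (π : ℂ)) ^ (2 * k) / ((2 * k + 1).factorial : ℂ) * t ^ (2 * k + 1)

end

/-!
All curves involved are instances of one family of recursions, depending on a scale `l` and on the
function `H = 1 / (ω₀₁ - σ^* ω₀₁)`, on the disjoint union of two copies of `ℂ`, one for each branch point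
`±1` of `x = z + z⁻¹` (`localCorr`). In the coordinates `z = ±1 + l t`, with the powers of `l` absorbed
into `ω_{g,n}`, every ingredient of the recursion extends continuously to `l = 0`: the bidifferential
decouples the two branch points, and the involution becomes `t ↦ -t`, so the recursion at `1` turns into
that of a curve with `x = t² / 2` (`joukowskyCurve_corr`, `halfSquareCurve_corr`).

The main tool is `RegularFamily.isRegularCorr`: if `H` depends continuously on a parameter and is
holomorphic in punctured neighbourhoods of the branch points, then all stable `ω_{g,n}` are jointly
continuous in the parameter and the points, and holomorphic in the points. This is an induction on
`2g + n`, in which the residues are replaced by integrals over circles of locally constant radius;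
holomorphy is what makes this possible.

For Okuyama's curve `y = (1/2) (z - z⁻¹) ∏ (1 - c_k w²)` with `w = (z - z⁻¹) / l`, because
`(1 - Q z²) (1 - Q z⁻²) = (1 - Q)² - Q (z - z⁻¹)²`. The product is continuous in `w` and in the sequence of
the `c_k`, as long as these are dominated by a summable sequence (`continuousOn_evenProduct`).
* Truncating the product replaces all but finitely many `c_k` by `0`, which is continuous in
  `M ∈ ℕ ∪ {∞}`; this gives the convergence of `ω^M_{g,n}`.
* For `q = exp (-λ)` and `l = λ` one has `c_k = (λ / (2 sinh (λ k / 2)))² ≤ 1 / k²`, which is continuous at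
  `λ = 0` with the value `1 / k²`. There `w = 2t`, and Euler's product turns `y` into the function
  `sin (2πt) / (2π)` of the Weil–Petersson curve, up to a factor that accounts for the power of `2`.

The truncated Weil–Petersson curves are treated by a bound on the order of the poles:
`moderateGrowth_localCorr` bounds `ω_{g,n}` by a power of `1 / ρ` as long as all points have distance
at least `ρ` from the branch point. Changing `H` by a term of high order at the branch point therefore
changes the integrand of the recursion by a bounded function, which has no residue
(`eventually_localCorr_eq`).
-/

noncomputable section

/-! ### Residues and circle integrals -/

theorem residueAt_congr {f g : ℂ → ℂ} {α : ℂ} (h : ∀ᶠ z in 𝓝[≠] α, f z = g z) :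
    residueAt f α = residueAt g α := by
  have key : ∀ᶠ r : ℝ in 𝓝[>] (0 : ℝ),
      (2 * (π : ℂ) * Complex.I)⁻¹ * (∮ z in C(α, r), f z) =
        (2 * (π : ℂ) * Complex.I)⁻¹ * ∮ z in C(α, r), g z := by
    obtain ⟨ε, hε, h⟩ := Metric.mem_nhdsWithin_iff.1 h
    filter_upwards [Ioo_mem_nhdsGT hε] with r hr
    congr 1
    refine circleIntegral.integral_congr hr.1.le fun z hz => h ⟨?_, ?_⟩
    · rw [Metric.mem_ball, Metric.mem_sphere.1 hz]
      exact hr.2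
    · rintro rfl
      simp only [Metric.mem_sphere, dist_self] at hz
      exact hr.1.ne hz
  unfold residueAt limUnder
  rw [Filter.map_congr key]

theorem residueAt_zero_fun (α : ℂ) : residueAt (fun _ => 0) α = 0 := by
  have h : ∀ r : ℝ, (∮ _z in C(α, r), (0 : ℂ)) = 0 := fun r => by simp [circleIntegral]
  simp only [residueAt, h, mul_zero]
  exact tendsto_const_nhds.limUnder_eq

theorem tendsto_circleIntegral_of_differentiableOn {f : ℂ → ℂ} {α : ℂ} {r R : ℝ} (hr : 0 < r)
    (hrR : r < R) (hf : DifferentiableOn ℂ f (Metric.ball α R \ {α})) :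
    Tendsto (fun s : ℝ => (2 * (π : ℂ) * Complex.I)⁻¹ * ∮ z in C(α, s), f z) (𝓝[>] 0)
      (𝓝 ((2 * (π : ℂ) * Complex.I)⁻¹ * ∮ z in C(α, r), f z)) := by
  refine tendsto_const_nhds.congr' ?_
  filter_upwards [Ioo_mem_nhdsGT hr] with s hs
  congr 1
  have hopen : IsOpen (Metric.ball α R \ {α}) := Metric.isOpen_ball.sdiff isClosed_singleton
  refine Complex.circleIntegral_eq_of_differentiable_on_annulus_off_countable hs.1 hs.2.le
    Set.countable_empty (hf.continuousOn.mono ?_) ?_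
  · rintro z ⟨h1, h2⟩
    refine ⟨lt_of_le_of_lt (Metric.mem_closedBall.1 h1) hrR, ?_⟩
    rintro rfl
    exact h2 (Metric.mem_ball_self hs.1)
  · rintro z ⟨⟨h1, h2⟩, -⟩
    refine (hf z ⟨lt_trans (Metric.mem_ball.1 h1) hrR, ?_⟩).differentiableAt
      (hopen.mem_nhds ⟨lt_trans (Metric.mem_ball.1 h1) hrR, ?_⟩) <;>
    · rintro rfl
      exact h2 (Metric.mem_closedBall_self hs.1.le)

theorem residueAt_eq_circleIntegral {f : ℂ → ℂ} {α : ℂ} {r R : ℝ} (hr : 0 < r)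
    (hrR : r < R) (hf : DifferentiableOn ℂ f (Metric.ball α R \ {α})) :
    residueAt f α = (2 * (π : ℂ) * Complex.I)⁻¹ * ∮ z in C(α, r), f z :=
  (tendsto_circleIntegral_of_differentiableOn hr hrR hf).limUnder_eq

/-- The constant comes out of the residue only because the residue exists: `residueAt` of a function
without a residue is a junk value. -/
theorem residueAt_const_mul {f : ℂ → ℂ} {α : ℂ} (c : ℂ)
    (hf : ∀ᶠ z in 𝓝[≠] α, DifferentiableAt ℂ f z) :
    residueAt (fun z => c * f z) α = c * residueAt f α := by
  obtain ⟨ε, hε, h⟩ := Metric.mem_nhdsWithin_iff.1 hf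
  have h1 : DifferentiableOn ℂ f (Metric.ball α ε \ {α}) :=
    fun z hz => (h ⟨hz.1, hz.2⟩).differentiableWithinAt
  rw [residueAt_eq_circleIntegral (half_pos hε) (half_lt_self hε) h1,
    residueAt_eq_circleIntegral (half_pos hε) (half_lt_self hε) (h1.const_mul c),
    circleIntegral.integral_const_mul]
  ring

theorem residueAt_comp_affine (f : ℂ → ℂ) (α : ℂ) {l : ℝ} (hl : 0 < l) :
    residueAt (fun t => (l : ℂ) * f (α + l * t)) 0 = residueAt f α := by
  have key : ∀ r : ℝ, (∮ t in C(0, r), (l : ℂ) * f (α + l * t)) = ∮ z in C(α, l * r), f z := by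
    intro r
    simp only [circleIntegral, deriv_circleMap, circleMap, smul_eq_mul]
    refine intervalIntegral.integral_congr fun θ _ => ?_
    push_cast
    ring_nf
  have hmap : map (fun r : ℝ => l * r) (𝓝[>] 0) = 𝓝[>] 0 := by
    have := (Homeomorph.mulLeft₀ l hl.ne').isEmbedding.map_nhdsWithin_eq (Set.Ioi 0) 0
    simpa [Homeomorph.coe_mulLeft₀, Set.image_mul_left_Ioi hl] using this
  unfold residueAt limUnder
  simp only [key]
  conv_rhs => rw [← hmap, Filter.map_map]
  rfl

theorem tendsto_residue_zero_of_bounded {f : ℂ → ℂ} {C : ℝ}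
    (hf : ∀ᶠ z in 𝓝[≠] (0 : ℂ), ‖f z‖ ≤ C) :
    Tendsto (fun s : ℝ => (2 * (π : ℂ) * Complex.I)⁻¹ * ∮ z in C(0, s), f z) (𝓝[>] 0) (𝓝 0) := by
  obtain ⟨ε, hε, h⟩ := Metric.mem_nhdsWithin_iff.1 hf
  have hlim : Tendsto (fun s : ℝ => s * C) (𝓝[>] 0) (𝓝 0) := by
    have : Tendsto (fun s : ℝ => s * C) (𝓝 0) (𝓝 (0 * C)) :=
      (continuous_id.mul continuous_const).tendsto 0
    simpa using this.mono_left nhdsWithin_le_nhds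
  refine squeeze_zero_norm' ?_ hlim
  filter_upwards [Ioo_mem_nhdsGT hε] with s hs
  have := circleIntegral.norm_two_pi_i_inv_smul_integral_le_of_norm_le_const (f := f) (c := 0)
    (R := s) (C := C) hs.1.le fun z hz => h ⟨?_, ?_⟩
  · simpa only [smul_eq_mul] using this
  · rw [Metric.mem_ball, Metric.mem_sphere.1 hz]
    exact hs.2
  · rintro rfl
    simp only [Metric.mem_sphere, dist_self] at hz
    exact hs.1.ne hz

/-! ### Circle integrals depending on a parameter -/

theorem continuous_deriv_circleMap (c : ℂ) (r : ℝ) : Continuous (deriv (circleMap c r)) := by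
  rw [show deriv (circleMap c r) = fun θ => circleMap 0 r θ * Complex.I from
    funext (deriv_circleMap c r)]
  fun_prop

theorem continuousOn_circleIntegral {T : Type*} [TopologicalSpace T] {S : Set T} {r : ℝ}
    {f : T → ℂ → ℂ} (hr : 0 ≤ r)
    (hf : ContinuousOn (fun q : T × ℂ => f q.1 q.2) (S ×ˢ Metric.sphere 0 r)) :
    ContinuousOn (fun t => ∮ z in C(0, r), f t z) S := by
  rw [continuousOn_iff_continuous_domRestrict]
  unfold circleIntegral
  refine intervalIntegral.continuous_parametric_intervalIntegral_of_continuous' ?_ 0 (2 * π)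
  refine Continuous.smul ((continuous_deriv_circleMap 0 r).comp continuous_snd) ?_
  refine hf.comp_continuous (f := fun q : S × ℝ => ((q.1 : T), circleMap 0 r q.2)) (by fun_prop)
    fun q => ⟨q.1.2, ?_⟩
  exact circleMap_mem_sphere 0 hr q.2

theorem differentiableOn_intervalIntegral {U : Set ℂ} (hU : IsOpen U) {f : ℂ → ℝ → ℂ} {a b : ℝ}
    (hc : ContinuousOn (fun q : ℂ × ℝ => f q.1 q.2) (U ×ˢ Set.univ))
    (hd : ∀ θ, DifferentiableOn ℂ (fun w => f w θ) U) :
    DifferentiableOn ℂ (fun w => ∫ θ in a..b, f w θ) U := by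
  intro w hw
  obtain ⟨ε, hε, hεU⟩ := Metric.isOpen_iff.1 hU w hw
  set δ := ε / 3 with hδ
  have hδ0 : 0 < δ := by positivity
  have hsub : Metric.closedBall w (2 * δ) ⊆ U := fun z hz =>
    hεU (lt_of_le_of_lt (Metric.mem_closedBall.1 hz) (by linarith))
  have hcθ : ∀ v ∈ U, Continuous (f v) := fun v hv =>
    hc.comp_continuous (f := fun θ : ℝ => (v, θ)) (by fun_prop) fun θ => ⟨hv, trivial⟩
  obtain ⟨C, hC⟩ : ∃ C, ∀ q ∈ Metric.closedBall w (2 * δ) ×ˢ Set.uIcc a b, ‖f q.1 q.2‖ ≤ C :=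
    ((isCompact_closedBall w (2 * δ)).prod isCompact_uIcc).exists_bound_of_continuousOn
      (hc.mono (Set.prod_mono hsub (Set.subset_univ _)))
  have hball : Metric.ball w δ ⊆ U := fun z hz => hsub
    (Metric.mem_closedBall.2 (by linarith [Metric.mem_ball.1 hz]))
  have hdiff : ∀ θ, ∀ v ∈ Metric.ball w δ, DifferentiableAt ℂ (fun w => f w θ) v :=
    fun θ v hv => (hd θ v (hball hv)).differentiableAt (hU.mem_nhds (hball hv))
  have hmeas : MeasureTheory.AEStronglyMeasurable (fun θ => deriv (fun w => f w θ) w)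
      (MeasureTheory.volume.restrict (Set.uIoc a b)) := by
    -- the derivative is a pointwise limit of difference quotients, which are continuous in `θ`
    have hu : Tendsto (fun n : ℕ => ((δ / 2 / ((n : ℝ) + 1) : ℝ) : ℂ)) atTop (𝓝[≠] 0) := by
      refine tendsto_nhdsWithin_iff.2 ⟨?_, Eventually.of_forall fun n => ?_⟩
      · have := (tendsto_one_div_add_atTop_nhds_zero_nat (𝕜 := ℝ)).const_mul (δ / 2)
        have h2 := (Complex.continuous_ofReal.tendsto _).comp this
        simpa [Function.comp_def, div_eq_mul_inv] using h2
      · simp only [Set.mem_compl_iff, Set.mem_singleton_iff, Complex.ofReal_eq_zero]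
        positivity
    refine aestronglyMeasurable_of_tendsto_ae atTop
      (f := fun (n : ℕ) θ => ((δ / 2 / ((n : ℝ) + 1) : ℝ) : ℂ)⁻¹ •
        (f (w + ((δ / 2 / ((n : ℝ) + 1) : ℝ) : ℂ)) θ - f w θ)) (fun n => ?_) ?_
    · refine Continuous.aestronglyMeasurable ?_
      refine Continuous.const_smul (M := ℂ) ((hcθ _ (hball ?_)).sub (hcθ w hw)) _
      rw [Metric.mem_ball, dist_self_add_left, Complex.norm_real, Real.norm_of_nonneg (by positivity)]
      have : δ / 2 / ((n : ℝ) + 1) ≤ δ / 2 := div_le_self (by positivity) (by linarith [n.cast_nonneg (α := ℝ)])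
      linarith
    · refine Eventually.of_forall fun θ => ?_
      exact (hasDerivAt_iff_tendsto_slope_zero.1
        (hdiff θ w (Metric.mem_ball_self hδ0)).hasDerivAt).comp hu
  refine (intervalIntegral.hasDerivAt_integral_of_dominated_loc_of_deriv_le
    (F' := fun v θ => deriv (fun w => f w θ) v) (bound := fun _ => C / δ)
    (Metric.ball_mem_nhds w hδ0) ?_ ((hcθ w hw).intervalIntegrable a b) hmeas ?_
    intervalIntegrable_const ?_).2.differentiableAt.differentiableWithinAt
  · filter_upwards [Metric.ball_mem_nhds w hδ0] with v hv
    exact (hcθ v (hball hv)).aestronglyMeasurable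
  · refine Eventually.of_forall fun θ hθ v hv => ?_
    have hvs : Metric.closedBall v δ ⊆ Metric.closedBall w (2 * δ) := fun z hz => by
      rw [Metric.mem_closedBall] at hz ⊢
      linarith [dist_triangle z v w, Metric.mem_ball.1 hv]
    refine Complex.norm_deriv_le_of_forall_mem_sphere_norm_le hδ0 ?_ fun z hz =>
      hC (z, θ) ⟨hvs (Metric.sphere_subset_closedBall hz), Set.uIoc_subset_uIcc hθ⟩
    refine DifferentiableOn.diffContOnCl ((hd θ).mono ?_)
    exact (Metric.closure_ball_subset_closedBall.trans hvs).trans hsub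
  · exact Eventually.of_forall fun θ _ v hv => (hdiff θ v hv).hasDerivAt

theorem differentiableOn_circleIntegral {U : Set ℂ} (hU : IsOpen U) {r : ℝ} (hr : 0 ≤ r)
    {f : ℂ → ℂ → ℂ}
    (hc : ContinuousOn (fun q : ℂ × ℂ => f q.1 q.2) (U ×ˢ Metric.sphere 0 r))
    (hd : ∀ z ∈ Metric.sphere (0 : ℂ) r, DifferentiableOn ℂ (fun w => f w z) U) :
    DifferentiableOn ℂ (fun w => ∮ z in C(0, r), f w z) U := by
  unfold circleIntegral
  refine differentiableOn_intervalIntegral hU ?_ fun θ =>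
    (hd _ (circleMap_mem_sphere 0 hr θ)).const_mul _
  refine ContinuousOn.smul
    ((continuous_deriv_circleMap 0 r).comp continuous_snd).continuousOn ?_
  exact hc.comp (f := fun q : ℂ × ℝ => (q.1, circleMap 0 r q.2)) (by fun_prop)
    fun q hq => ⟨hq.1, circleMap_mem_sphere 0 hr q.2⟩

/-! ### The recursion -/

/-- The bracket of the topological recursion for a family `V g n` of functions of `n` points of an
arbitrary set `X`: the points `x` and `y` take the places of `z` and `σ(z)`, and `z` lists the
remaining arguments. -/
def bracket {X : Type*} (V : (g n : ℕ) → (Fin n → X) → ℂ) (g m : ℕ) (x y : X) (z : Fin m → X) : ℂ :=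
  (if 0 < g then V (g - 1) (m + 2) (Fin.cons x (Fin.cons y z)) else 0) +
    ∑ g₁ : Fin (g + 1), ∑ I : Finset (Fin m),
      if ¬ (g₁.val = 0 ∧ I.card = 0) ∧ ¬ (g - g₁.val = 0 ∧ Iᶜ.card = 0) then
        V g₁.val (I.card + 1) (Fin.cons x fun i => z (I.orderEmbOfFin rfl i)) *
        V (g - g₁.val) (Iᶜ.card + 1) (Fin.cons y fun i => z (Iᶜ.orderEmbOfFin rfl i))
      else 0

theorem RationalSpectralCurve.corr_succ (C : RationalSpectralCurve) {g m : ℕ}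
    (h : 2 ≤ 2 * g + m) (z : Fin (m + 1) → ℂ) :
    C.corr g (m + 1) z = ∑ᶠ α ∈ branchPoints C.x, residueAt (fun p : ℂ =>
      C.kernel α (z 0) p * deriv (C.σ α) p *
        bracket C.corr g m p (C.σ α p) fun i => z i.succ) α := by
  rw [RationalSpectralCurve.corr]
  · simp only [bracket, dite_eq_ite]
  · intro h0 _ h1
    omega
  · intro h0 _ h1
    omega

/-- The sign `±1` of the branch point with a given label. -/
def sgn (a : Bool) : ℂ := if a then 1 else -1

@[simp] theorem sgn_true : sgn true = 1 := rfl

@[simp] theorem sgn_false : sgn false = -1 := rfl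

theorem sgn_mul_self (a : Bool) : sgn a * sgn a = 1 := by cases a <;> simp

theorem sgn_ne_zero (a : Bool) : sgn a ≠ 0 := by cases a <;> simp

theorem sgn_sub_of_ne {a b : Bool} (h : a ≠ b) : sgn a - sgn b = 2 * sgn a := by
  cases a <;> cases b <;> simp at h ⊢ <;> norm_num

/-- The position `±1 + l t` on the `z`-plane of the point with local coordinate `t` at the branch
point `±1`. -/
def position (l : ℂ) (x : Bool × ℂ) : ℂ := sgn x.1 + l * x.2

/-- The separation of two points in local coordinates; the factor `l` is divided out when the
points belong to the same branch point, so that the separation stays meaningful for `l = 0`. -/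
def separation (l : ℂ) (x y : Bool × ℂ) : ℂ :=
  if x.1 = y.1 then x.2 - y.2 else sgn x.1 - sgn y.1 + l * (x.2 - y.2)

/-- The rescaled Cauchy kernel `l / (z - w)` in local coordinates. For `l = 0` it decouples the two
branch points. Its square is the rescaled bidifferential `ω₀₂`. -/
def cauchyKernel (l : ℂ) (x y : Bool × ℂ) : ℂ :=
  (if x.1 = y.1 then 1 else l) / separation l x y

/-- The involution `z ↦ z⁻¹` in the local coordinate at the branch point `sgn a`. For `l = 0` it is
`t ↦ -t`. -/
def localInvolution (l : ℂ) (a : Bool) (t : ℂ) : ℂ := -t / (1 + sgn a * l * t)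

/-- The recursion kernel in local coordinates, together with the factor that comes from
pulling back along the involution. The function `H a` is the reciprocal of
`ω₀₁(z) - ω₀₁(σ(z))` at the branch point with label `a`. -/
def localKernel (l : ℂ) (H : Bool → ℂ → ℂ) (a : Bool) (x : Bool × ℂ) (t : ℂ) : ℂ :=
  1 / 2 * (cauchyKernel l x (a, localInvolution l a t) - cauchyKernel l x (a, t)) * H a t *
    (-1 / (1 + sgn a * l * t) ^ 2)

/-- The correlation functions of a spectral curve with two branch points, in the local
coordinates `z = ±1 + l t` blown up by the factor `l⁻¹`. For `l = 1` this is the recursion of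
`joukowskyCurve`; for `l = 0` the points at one branch point no longer interact with the other branch
point, and each branch point carries the recursion of `halfSquareCurve`. -/
def localCorr (l : ℂ) (H : Bool → ℂ → ℂ) : (g n : ℕ) → (Fin n → Bool × ℂ) → ℂ
  | _, 0, _ => 0
  | 0, 1, _ => 0
  | 0, 2, z => cauchyKernel l (z 0) (z 1) ^ 2
  | g, m + 1, z =>
    ∑ a : Bool, residueAt (fun p : ℂ =>
      localKernel l H a (z 0) p *
        ((if _h : 0 < g then
            localCorr l H (g - 1) (m + 2)
              (Fin.cons (a, p) (Fin.cons (a, localInvolution l a p) fun i : Fin m => z i.succ))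
          else 0) +
        ∑ g₁ : Fin (g + 1), ∑ I : Finset (Fin m),
          if _h : ¬ (g₁.val = 0 ∧ I.card = 0) ∧ ¬ (g - g₁.val = 0 ∧ Iᶜ.card = 0) then
            localCorr l H g₁.val (I.card + 1)
              (Fin.cons (a, p) fun i => z (I.orderEmbOfFin rfl i).succ) *
            localCorr l H (g - g₁.val) (Iᶜ.card + 1)
              (Fin.cons (a, localInvolution l a p) fun i => z (Iᶜ.orderEmbOfFin rfl i).succ)
          else 0)) 0
termination_by g n => 2 * g + n
decreasing_by
  · omega
  · have h1 := I.card_add_card_compl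
    rw [Fintype.card_fin] at h1
    have h2 := g₁.isLt
    omega
  · have h1 := I.card_add_card_compl
    rw [Fintype.card_fin] at h1
    have h2 := g₁.isLt
    omega

theorem localCorr_zero_two (l : ℂ) (H : Bool → ℂ → ℂ) (z : Fin 2 → Bool × ℂ) :
    localCorr l H 0 2 z = cauchyKernel l (z 0) (z 1) ^ 2 := by
  rw [localCorr]

/-- The integrand of the recursion for `localCorr` at the branch point with label `a`. -/
def localIntegrand (l : ℂ) (H : Bool → ℂ → ℂ) (g m : ℕ) (a : Bool) (z : Fin (m + 1) → Bool × ℂ)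
    (p : ℂ) : ℂ :=
  localKernel l H a (z 0) p *
    bracket (localCorr l H) g m (a, p) (a, localInvolution l a p) fun i => z i.succ

theorem localCorr_succ (l : ℂ) (H : Bool → ℂ → ℂ) {g m : ℕ} (h : 2 ≤ 2 * g + m)
    (z : Fin (m + 1) → Bool × ℂ) :
    localCorr l H g (m + 1) z = ∑ a : Bool, residueAt (localIntegrand l H g m a z) 0 := by
  rw [localCorr]
  · simp only [dite_eq_ite]
    rfl
  · intro h0 _ h1
    omega
  · intro h0 _ h1
    omega

/-- A property of functions that is stable under sums and products passes to the bracket. -/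
theorem bracket_induction {X T : Type*} (P : (T → ℂ) → Prop) (zero : P fun _ => 0)
    (add : ∀ f f', P f → P f' → P fun t => f t + f' t)
    (mul : ∀ f f', P f → P f' → P fun t => f t * f' t)
    {V : T → (g n : ℕ) → (Fin n → X) → ℂ} {g m : ℕ} {x y : T → X} {z : T → Fin m → X}
    (hxy : 0 < g →
      P fun t => V t (g - 1) (m + 2) (Fin.cons (x t) (Fin.cons (y t) (z t))))
    (hx : ∀ (g' k : ℕ) (e : Fin k → Fin m), 1 ≤ 2 * g' + k → 2 * g' + k < 2 * g + m →
      P fun t => V t g' (k + 1) (Fin.cons (x t) fun i => z t (e i)))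
    (hy : ∀ (g' k : ℕ) (e : Fin k → Fin m), 1 ≤ 2 * g' + k → 2 * g' + k < 2 * g + m →
      P fun t => V t g' (k + 1) (Fin.cons (y t) fun i => z t (e i))) :
    P fun t => bracket (V t) g m (x t) (y t) (z t) := by
  have sum : ∀ (κ : Type) (s : Finset κ) (f : κ → T → ℂ), (∀ i, P (f i)) →
      P fun t => ∑ i ∈ s, f i t := by
    intro κ s f hf
    classical
    induction s using Finset.induction_on with
    | empty => simpa using zero
    | insert i s hi ih => simpa only [Finset.sum_insert hi] using add _ _ (hf i) ih
  unfold bracket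
  refine add _ _ ?_ (sum _ _ _ fun g₁ => sum _ _ _ fun I => ?_)
  · split_ifs with h
    · exact hxy h
    · exact zero
  · have h1 := I.card_add_card_compl
    rw [Fintype.card_fin] at h1
    have h2 := g₁.isLt
    split_ifs with h
    · exact mul _ _ (hx _ _ _ (by omega) (by omega)) (hy _ _ _ (by omega) (by omega))
    · exact zero

/-! ### Regularity of the local correlation functions -/

theorem separation_neg (l : ℂ) (x y : Bool × ℂ) : separation l x y = -separation l y x := by
  unfold separation
  by_cases h : x.1 = y.1
  · rw [if_pos h, if_pos h.symm]
    ring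
  · rw [if_neg h, if_neg (Ne.symm h)]
    ring

theorem continuous_separation :
    Continuous fun q : ℂ × (Bool × ℂ) × (Bool × ℂ) => separation q.1 q.2.1 q.2.2 := by
  have hs : Continuous sgn := continuous_of_discreteTopology
  -- the case distinction on the labels becomes a polynomial in their signs
  have h : (fun q : ℂ × (Bool × ℂ) × (Bool × ℂ) => separation q.1 q.2.1 q.2.2) =
      fun q => (1 + sgn q.2.1.1 * sgn q.2.2.1) / 2 * (q.2.1.2 - q.2.2.2) +
        (1 - sgn q.2.1.1 * sgn q.2.2.1) / 2 *
          (sgn q.2.1.1 - sgn q.2.2.1 + q.1 * (q.2.1.2 - q.2.2.2)) := by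
    funext ⟨l, ⟨a, s⟩, ⟨b, t⟩⟩
    cases a <;> cases b <;> simp [separation]
  rw [h]
  fun_prop

theorem continuousOn_cauchyKernel {T : Type*} [TopologicalSpace T] {S : Set T} {l : T → ℂ}
    {x y : T → Bool × ℂ} (hl : ContinuousOn l S) (hx : ContinuousOn x S) (hy : ContinuousOn y S)
    (h : ∀ t ∈ S, separation (l t) (x t) (y t) ≠ 0) :
    ContinuousOn (fun t => cauchyKernel (l t) (x t) (y t)) S := by
  have hs : Continuous sgn := continuous_of_discreteTopology
  have hnum : Continuous fun q : ℂ × (Bool × ℂ) × (Bool × ℂ) =>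
      if q.2.1.1 = q.2.2.1 then 1 else q.1 := by
    have h : (fun q : ℂ × (Bool × ℂ) × (Bool × ℂ) => if q.2.1.1 = q.2.2.1 then 1 else q.1) =
        fun q => (1 + sgn q.2.1.1 * sgn q.2.2.1) / 2 +
          (1 - sgn q.2.1.1 * sgn q.2.2.1) / 2 * q.1 := by
      funext ⟨l, ⟨a, s⟩, ⟨b, t⟩⟩
      cases a <;> cases b <;> simp
    rw [h]
    fun_prop
  have hq : ContinuousOn (fun t => (l t, x t, y t)) S := hl.prodMk (hx.prodMk hy)
  exact (hnum.comp_continuousOn hq).div (continuous_separation.comp_continuousOn hq) h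

/-- A holomorphic curve on `U` in the disjoint union of two copies of `ℂ`. -/
def HolomorphicCurve (γ : ℂ → Bool × ℂ) (U : Set ℂ) : Prop :=
  ∃ b, (∀ w ∈ U, (γ w).1 = b) ∧ DifferentiableOn ℂ (fun w => (γ w).2) U

theorem HolomorphicCurve.const (x : Bool × ℂ) (U : Set ℂ) : HolomorphicCurve (fun _ => x) U :=
  ⟨x.1, fun _ _ => rfl, differentiableOn_const _⟩

theorem HolomorphicCurve.mk_label (a : Bool) {p : ℂ → ℂ} {U : Set ℂ} (hp : DifferentiableOn ℂ p U) :
    HolomorphicCurve (fun w => (a, p w)) U :=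
  ⟨a, fun _ _ => rfl, hp⟩

theorem HolomorphicCurve.mono {γ : ℂ → Bool × ℂ} {U V : Set ℂ} (h : HolomorphicCurve γ U)
    (hV : V ⊆ U) : HolomorphicCurve γ V :=
  let ⟨b, h1, h2⟩ := h
  ⟨b, fun w hw => h1 w (hV hw), h2.mono hV⟩

theorem HolomorphicCurve.continuousOn {γ : ℂ → Bool × ℂ} {U : Set ℂ} (h : HolomorphicCurve γ U) :
    ContinuousOn γ U := by
  obtain ⟨b, h1, h2⟩ := h
  exact (continuousOn_const (c := b)).prodMk h2.continuousOn |>.congr fun w hw => by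
    simp [← h1 w hw]

theorem HolomorphicCurve.cauchyKernel {γ δ : ℂ → Bool × ℂ} {U : Set ℂ} (l : ℂ)
    (hγ : HolomorphicCurve γ U) (hδ : HolomorphicCurve δ U)
    (h : ∀ w ∈ U, separation l (γ w) (δ w) ≠ 0) :
    DifferentiableOn ℂ (fun w => cauchyKernel l (γ w) (δ w)) U := by
  obtain ⟨a, ha, h1⟩ := hγ
  obtain ⟨b, hb, h2⟩ := hδ
  unfold _root_.cauchyKernel
  refine DifferentiableOn.div ?_ ?_ h
  · exact (differentiableOn_const (c := if a = b then 1 else l)).congr fun w hw => by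
      rw [ha w hw, hb w hw]
  · have h3 : DifferentiableOn ℂ (fun w => if a = b then (γ w).2 - (δ w).2 else
        sgn a - sgn b + l * ((γ w).2 - (δ w).2)) U := by
      split_ifs
      · exact h1.sub h2
      · exact ((h1.sub h2).const_mul l).const_add _
    exact h3.congr fun w hw => by rw [separation, ha w hw, hb w hw]

/-- The points that are not one of the two branch points, in local coordinates with scale `l`. -/
def regularPoints (l : ℂ) : Set (Bool × ℂ) := {x | x.2 ≠ 0 ∧ 2 * sgn x.1 + l * x.2 ≠ 0}

/-- The configurations of regular points in which the first point is different from the others. -/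
def separatedConfigurations (l : ℂ) (k : ℕ) : Set (Fin (k + 1) → Bool × ℂ) :=
  {z | (∀ i, z i ∈ regularPoints l) ∧ ∀ i : Fin k, separation l (z 0) (z i.succ) ≠ 0}

/-- A family of local recursions over a parameter space, whose kernels depend continuously on the
parameter and are holomorphic near the branch points, except at the branch points themselves. -/
structure RegularFamily {Λ : Type*} [TopologicalSpace Λ] (l : Λ → ℂ) (H : Λ → Bool → ℂ → ℂ) :
    Prop where
  continuous_scale : Continuous l
  regular : ∀ τ a, ∀ᶠ q in 𝓝 (τ, (0 : ℂ)), q.2 ≠ 0 →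
    ContinuousAt (fun q : Λ × ℂ => H q.1 a q.2) q ∧ DifferentiableAt ℂ (H q.1 a) q.2

section Regularity

variable {Λ : Type*} [TopologicalSpace Λ] {l : Λ → ℂ} {H : Λ → Bool → ℂ → ℂ}

/-- The triples `(τ, z, p)` at which the integrand of the recursion is regular. -/
def integrandDomain (l : Λ → ℂ) (H : Λ → Bool → ℂ → ℂ) (m : ℕ) (a : Bool) :
    Set (Λ × (Fin (m + 1) → Bool × ℂ) × ℂ) :=
  {q | q.2.2 ≠ 0 ∧ (∀ i, q.2.1 i ∈ regularPoints (l q.1)) ∧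
    1 + sgn a * l q.1 * q.2.2 ≠ 0 ∧ 2 * sgn a + l q.1 * q.2.2 ≠ 0 ∧
    2 * sgn a + l q.1 * localInvolution (l q.1) a q.2.2 ≠ 0 ∧
    (∀ i, separation (l q.1) (q.2.1 i) (a, q.2.2) ≠ 0) ∧
    (∀ i, separation (l q.1) (q.2.1 i) (a, localInvolution (l q.1) a q.2.2) ≠ 0) ∧
    ContinuousAt (fun q : Λ × ℂ => H q.1 a q.2) (q.1, q.2.2) ∧
    DifferentiableAt ℂ (H q.1 a) q.2.2}

theorem localInvolution_ne_zero {l : ℂ} {a : Bool} {p : ℂ} (hp : p ≠ 0)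
    (h : 1 + sgn a * l * p ≠ 0) : localInvolution l a p ≠ 0 :=
  div_ne_zero (neg_ne_zero.2 hp) h

theorem separation_localInvolution {l : ℂ} {a : Bool} {p : ℂ} (hp : p ≠ 0)
    (h : 1 + sgn a * l * p ≠ 0) (h2 : 2 * sgn a + l * p ≠ 0) :
    separation l (a, p) (a, localInvolution l a p) ≠ 0 := by
  have h3 : separation l (a, p) (a, localInvolution l a p) =
      p * (sgn a * (2 * sgn a + l * p)) / (1 + sgn a * l * p) := by
    simp only [separation, localInvolution, if_true]
    rw [eq_div_iff h, sub_mul, div_mul_cancel₀ _ h]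
    linear_combination (-2 * p) * sgn_mul_self a
  rw [h3]
  exact div_ne_zero (mul_ne_zero hp (mul_ne_zero (sgn_ne_zero a) h2)) h

theorem cons_mem_separatedConfigurations {m k : ℕ} {a : Bool}
    {q : Λ × (Fin (m + 1) → Bool × ℂ) × ℂ} (hq : q ∈ integrandDomain l H m a)
    (e : Fin k → Fin m) :
    (Fin.cons (a, q.2.2) (fun i => q.2.1 (e i).succ) : Fin (k + 1) → Bool × ℂ) ∈
      separatedConfigurations (l q.1) k := by
  obtain ⟨h1, h2, h3, h4, h5, h6, h7, -⟩ := hq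
  refine ⟨?_, fun i => ?_⟩
  · exact Fin.cases ⟨h1, h4⟩ fun i => by simpa using h2 _
  · simp only [Fin.cons_zero, Fin.cons_succ]
    rw [separation_neg, neg_ne_zero]
    exact h6 _

theorem cons_involution_mem_separatedConfigurations {m k : ℕ} {a : Bool}
    {q : Λ × (Fin (m + 1) → Bool × ℂ) × ℂ} (hq : q ∈ integrandDomain l H m a)
    (e : Fin k → Fin m) :
    (Fin.cons (a, localInvolution (l q.1) a q.2.2) (fun i => q.2.1 (e i).succ) :
      Fin (k + 1) → Bool × ℂ) ∈ separatedConfigurations (l q.1) k := by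
  obtain ⟨h1, h2, h3, h4, h5, h6, h7, -⟩ := hq
  refine ⟨?_, fun i => ?_⟩
  · exact Fin.cases ⟨localInvolution_ne_zero h1 h3, h5⟩ fun i => by simpa using h2 _
  · simp only [Fin.cons_zero, Fin.cons_succ]
    rw [separation_neg, neg_ne_zero]
    exact h7 _

theorem cons_cons_mem_separatedConfigurations {m : ℕ} {a : Bool}
    {q : Λ × (Fin (m + 1) → Bool × ℂ) × ℂ} (hq : q ∈ integrandDomain l H m a) :
    (Fin.cons (a, q.2.2) (Fin.cons (a, localInvolution (l q.1) a q.2.2)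
      (fun i => q.2.1 i.succ)) : Fin (m + 1 + 1) → Bool × ℂ) ∈
      separatedConfigurations (l q.1) (m + 1) := by
  obtain ⟨h1, h2, h3, h4, h5, h6, h7, -⟩ := hq
  refine ⟨?_, ?_⟩
  · exact Fin.cases ⟨h1, h4⟩ (Fin.cases ⟨localInvolution_ne_zero h1 h3, h5⟩ fun i => by
      simpa using h2 _)
  refine Fin.cases ?_ fun i => ?_
  · simpa using separation_localInvolution h1 h3 h4
  · simp only [Fin.cons_zero, Fin.cons_succ]
    rw [separation_neg, neg_ne_zero]
    exact h6 _

/-- Near a configuration of regular points, the integrand of the recursion is regular in a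
punctured disc around the branch point whose radius does not depend on the configuration. -/
theorem RegularFamily.eventually_mem_integrandDomain (hH : RegularFamily l H) {m : ℕ} (a : Bool)
    {τ : Λ} {z : Fin (m + 1) → Bool × ℂ} (hz : ∀ i, z i ∈ regularPoints (l τ)) :
    ∀ᶠ q in 𝓝 (τ, z, (0 : ℂ)), q.2.2 ≠ 0 → q ∈ integrandDomain l H m a := by
  have hl := hH.continuous_scale
  have hs : Continuous sgn := continuous_of_discreteTopology
  let q₀ : Λ × (Fin (m + 1) → Bool × ℂ) × ℂ := (τ, z, 0)
  have hinv : ContinuousAt (fun q : Λ × (Fin (m + 1) → Bool × ℂ) × ℂ =>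
      localInvolution (l q.1) a q.2.2) q₀ := by
    unfold localInvolution
    refine ContinuousAt.div (by fun_prop) (by fun_prop) ?_
    simp [q₀]
  have hinv0 : localInvolution (l τ) a 0 = 0 := by simp [localInvolution]
  have hsep0 : ∀ i, separation (l τ) (z i) (a, 0) ≠ 0 := by
    intro i
    unfold separation
    split_ifs with h
    · simpa using (hz i).1
    · simpa [sgn_sub_of_ne h] using (hz i).2
  have e1 : ∀ᶠ q in 𝓝 q₀, ∀ i, q.2.1 i ∈ regularPoints (l q.1) := by
    refine eventually_all.2 fun i => ?_
    have c1 : ContinuousAt (fun q : Λ × (Fin (m + 1) → Bool × ℂ) × ℂ => (q.2.1 i).2) q₀ := by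
      fun_prop
    have c2 : ContinuousAt (fun q : Λ × (Fin (m + 1) → Bool × ℂ) × ℂ =>
        2 * sgn (q.2.1 i).1 + l q.1 * (q.2.1 i).2) q₀ := by
      fun_prop
    exact (c1.eventually_ne (hz i).1).and (c2.eventually_ne (hz i).2)
  have e2 : ∀ᶠ q in 𝓝 q₀, 1 + sgn a * l q.1 * q.2.2 ≠ 0 :=
    ContinuousAt.eventually_ne (by fun_prop) (by simp [q₀])
  have e3 : ∀ᶠ q in 𝓝 q₀, 2 * sgn a + l q.1 * q.2.2 ≠ 0 :=
    ContinuousAt.eventually_ne (by fun_prop) (by simp [q₀, sgn_ne_zero])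
  have e4 : ∀ᶠ q in 𝓝 q₀, 2 * sgn a + l q.1 * localInvolution (l q.1) a q.2.2 ≠ 0 :=
    ContinuousAt.eventually_ne (by fun_prop) (by simp [q₀, hinv0, sgn_ne_zero])
  have e5 : ∀ᶠ q in 𝓝 q₀, ∀ i, separation (l q.1) (q.2.1 i) (a, q.2.2) ≠ 0 := by
    refine eventually_all.2 fun i => ContinuousAt.eventually_ne (y := 0) ?_ (hsep0 i)
    exact continuous_separation.continuousAt.comp (f := fun q : Λ × (Fin (m + 1) → Bool × ℂ) × ℂ =>
      (l q.1, q.2.1 i, (a, q.2.2))) (by fun_prop)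
  have e6 : ∀ᶠ q in 𝓝 q₀, ∀ i,
      separation (l q.1) (q.2.1 i) (a, localInvolution (l q.1) a q.2.2) ≠ 0 := by
    refine eventually_all.2 fun i => ContinuousAt.eventually_ne (y := 0) ?_ ?_
    · exact continuous_separation.continuousAt.comp
        (f := fun q : Λ × (Fin (m + 1) → Bool × ℂ) × ℂ =>
          (l q.1, q.2.1 i, (a, localInvolution (l q.1) a q.2.2))) (by fun_prop)
    · simpa [q₀, hinv0] using hsep0 i
  have e7 : ∀ᶠ q in 𝓝 q₀, q.2.2 ≠ 0 →
      ContinuousAt (fun q : Λ × ℂ => H q.1 a q.2) (q.1, q.2.2) ∧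
        DifferentiableAt ℂ (H q.1 a) q.2.2 := by
    have c : ContinuousAt (fun q : Λ × (Fin (m + 1) → Bool × ℂ) × ℂ => (q.1, q.2.2)) q₀ := by
      fun_prop
    exact c.tendsto.eventually (hH.regular τ a)
  filter_upwards [e1, e2, e3, e4, e5, e6, e7] with q h1 h2 h3 h4 h5 h6 h7 h0
  exact ⟨h0, h1, h2, h3, h4, h5, h6, h7 h0⟩

/-- Joint continuity of `localCorr` in the parameter and the points, and holomorphy in the points. -/
structure IsRegularCorr (l : Λ → ℂ) (H : Λ → Bool → ℂ → ℂ) (g k : ℕ)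
    (D : ℂ → Set (Fin (k + 1) → Bool × ℂ)) : Prop where
  continuousOn : ContinuousOn
    (fun q : Λ × (Fin (k + 1) → Bool × ℂ) => localCorr (l q.1) (H q.1) g (k + 1) q.2)
    {q | q.2 ∈ D (l q.1)}
  differentiableOn : ∀ (τ : Λ) (U : Set ℂ) (γ : ℂ → Fin (k + 1) → Bool × ℂ), IsOpen U →
    (∀ i, HolomorphicCurve (fun w => γ w i) U) → (∀ w ∈ U, γ w ∈ D (l τ)) →
    DifferentiableOn ℂ (fun w => localCorr (l τ) (H τ) g (k + 1) (γ w)) U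

theorem RegularFamily.isRegularCorr_zero_two (hH : RegularFamily l H) :
    IsRegularCorr l H 0 1 fun l => separatedConfigurations l 1 where
  continuousOn := by
    have hl := hH.continuous_scale
    refine (ContinuousOn.pow (continuousOn_cauchyKernel (by fun_prop) (by fun_prop) (by fun_prop)
      fun q hq => ?_) 2).congr fun q _ => localCorr_zero_two _ _ _
    exact hq.2 0
  differentiableOn := by
    intro τ U γ hU hγ h
    exact (((hγ 0).cauchyKernel (l τ) (hγ 1) fun w hw => (h w hw).2 0).pow 2).congr
      fun w _ => localCorr_zero_two _ _ _

theorem continuousOn_localIntegrand (hH : RegularFamily l H) {g m : ℕ}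
    (ih : ∀ g' k, 1 ≤ 2 * g' + k → 2 * g' + k < 2 * g + m →
      IsRegularCorr l H g' k fun l => separatedConfigurations l k) (a : Bool) :
    ContinuousOn (fun q : Λ × (Fin (m + 1) → Bool × ℂ) × ℂ =>
      localIntegrand (l q.1) (H q.1) g m a q.2.1 q.2.2) (integrandDomain l H m a) := by
  have hl := hH.continuous_scale
  have hinv : ContinuousOn (fun q : Λ × (Fin (m + 1) → Bool × ℂ) × ℂ =>
      localInvolution (l q.1) a q.2.2) (integrandDomain l H m a) := by
    unfold localInvolution
    exact ContinuousOn.div (by fun_prop) (by fun_prop) fun q hq => hq.2.2.1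
  refine ContinuousOn.mul ?_ ?_
  · unfold localKernel
    refine ContinuousOn.mul (ContinuousOn.mul (continuousOn_const.mul (ContinuousOn.sub
      (continuousOn_cauchyKernel (by fun_prop) (by fun_prop) (by fun_prop)
        fun q hq => hq.2.2.2.2.2.2.1 0)
      (continuousOn_cauchyKernel (by fun_prop) (by fun_prop) (by fun_prop)
        fun q hq => hq.2.2.2.2.2.1 0))) ?_) ?_
    · intro q hq
      exact (ContinuousAt.comp (f := fun q : Λ × (Fin (m + 1) → Bool × ℂ) × ℂ => (q.1, q.2.2))
        hq.2.2.2.2.2.2.2.1 (by fun_prop)).continuousWithinAt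
    · exact ContinuousOn.div (by fun_prop) (by fun_prop) fun q hq => pow_ne_zero 2 hq.2.2.1
  · refine bracket_induction (fun f => ContinuousOn f (integrandDomain l H m a))
      continuousOn_const (fun _ _ => ContinuousOn.add) (fun _ _ => ContinuousOn.mul) ?_ ?_ ?_
    · intro hg
      refine (ih (g - 1) (m + 1) (by omega) (by omega)).continuousOn.comp
        (f := fun q : Λ × (Fin (m + 1) → Bool × ℂ) × ℂ => (q.1, (Fin.cons (a, q.2.2) (Fin.cons
          (a, localInvolution (l q.1) a q.2.2) fun i : Fin m => q.2.1 i.succ) :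
            Fin (m + 1 + 1) → Bool × ℂ))) ?_ fun q hq => cons_cons_mem_separatedConfigurations hq
      refine continuousOn_fst.prodMk (continuousOn_pi.2 (Fin.cases ?_ (Fin.cases ?_ fun i => ?_)))
      · simp only [Fin.cons_zero]; fun_prop
      · simp only [Fin.cons_zero, Fin.cons_succ]; fun_prop
      · simp only [Fin.cons_succ]; fun_prop
    · intro g' k e h1 h2
      refine (ih g' k h1 h2).continuousOn.comp
        (f := fun q : Λ × (Fin (m + 1) → Bool × ℂ) × ℂ => (q.1, (Fin.cons (a, q.2.2)
          (fun i => q.2.1 (e i).succ) : Fin (k + 1) → Bool × ℂ))) ?_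
          fun q hq => cons_mem_separatedConfigurations hq e
      refine continuousOn_fst.prodMk (continuousOn_pi.2 (Fin.cases ?_ fun i => ?_))
      · simp only [Fin.cons_zero]; fun_prop
      · simp only [Fin.cons_succ]; fun_prop
    · intro g' k e h1 h2
      refine (ih g' k h1 h2).continuousOn.comp
        (f := fun q : Λ × (Fin (m + 1) → Bool × ℂ) × ℂ => (q.1, (Fin.cons
          (a, localInvolution (l q.1) a q.2.2) (fun i => q.2.1 (e i).succ) :
            Fin (k + 1) → Bool × ℂ))) ?_ fun q hq => cons_involution_mem_separatedConfigurations hq e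
      refine continuousOn_fst.prodMk (continuousOn_pi.2 (Fin.cases ?_ fun i => ?_))
      · simp only [Fin.cons_zero]; fun_prop
      · simp only [Fin.cons_succ]; fun_prop

theorem differentiableOn_localIntegrand {g m : ℕ}
    (ih : ∀ g' k, 1 ≤ 2 * g' + k → 2 * g' + k < 2 * g + m →
      IsRegularCorr l H g' k fun l => separatedConfigurations l k) (a : Bool) (τ : Λ) {U : Set ℂ}
    (hU : IsOpen U) {γ : ℂ → Fin (m + 1) → Bool × ℂ} (hγ : ∀ i, HolomorphicCurve (fun w => γ w i) U)
    {p : ℂ → ℂ} (hp : DifferentiableOn ℂ p U)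
    (h : ∀ w ∈ U, (τ, γ w, p w) ∈ integrandDomain l H m a) :
    DifferentiableOn ℂ (fun w => localIntegrand (l τ) (H τ) g m a (γ w) (p w)) U := by
  have hinv : DifferentiableOn ℂ (fun w => localInvolution (l τ) a (p w)) U := by
    unfold localInvolution
    exact DifferentiableOn.div (by fun_prop) (by fun_prop) fun w hw => (h w hw).2.2.1
  refine DifferentiableOn.mul ?_ ?_
  · unfold localKernel
    refine DifferentiableOn.mul (DifferentiableOn.mul ((differentiableOn_const _).mul
      (DifferentiableOn.sub
      ((hγ 0).cauchyKernel _ (.mk_label a hinv) fun w hw => (h w hw).2.2.2.2.2.2.1 0)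
      ((hγ 0).cauchyKernel _ (.mk_label a hp) fun w hw => (h w hw).2.2.2.2.2.1 0))) ?_) ?_
    · intro w hw
      exact DifferentiableAt.comp_differentiableWithinAt w (h w hw).2.2.2.2.2.2.2.2 (hp w hw)
    · exact DifferentiableOn.div (by fun_prop) (by fun_prop) fun w hw =>
        pow_ne_zero 2 (h w hw).2.2.1
  · refine bracket_induction (V := fun _ => localCorr (l τ) (H τ)) (fun f => DifferentiableOn ℂ f U)
      (differentiableOn_const _) (fun _ _ => DifferentiableOn.add) (fun _ _ => DifferentiableOn.mul)
      ?_ ?_ ?_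
    · intro hg
      refine (ih (g - 1) (m + 1) (by omega) (by omega)).differentiableOn τ U _ hU
        (Fin.cases ?_ (Fin.cases ?_ fun i => ?_)) fun w hw =>
          cons_cons_mem_separatedConfigurations (h w hw)
      · exact .mk_label a hp
      · exact .mk_label a hinv
      · exact hγ _
    · intro g' k e h1 h2
      refine (ih g' k h1 h2).differentiableOn τ U _ hU
        (Fin.cases ?_ fun i => ?_) fun w hw => cons_mem_separatedConfigurations (h w hw) e
      · exact .mk_label a hp
      · exact hγ _
    · intro g' k e h1 h2
      refine (ih g' k h1 h2).differentiableOn τ U _ hU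
        (Fin.cases ?_ fun i => ?_) fun w hw =>
          cons_involution_mem_separatedConfigurations (h w hw) e
      · exact .mk_label a hinv
      · exact hγ _

/-- Near a configuration of regular points, the residues of the recursion are integrals over
circles of a fixed radius. -/
theorem RegularFamily.exists_circle (hH : RegularFamily l H) {g m : ℕ} (hgm : 2 ≤ 2 * g + m)
    (ih : ∀ g' k, 1 ≤ 2 * g' + k → 2 * g' + k < 2 * g + m →
      IsRegularCorr l H g' k fun l => separatedConfigurations l k)
    {τ : Λ} {z : Fin (m + 1) → Bool × ℂ} (hz : ∀ i, z i ∈ regularPoints (l τ)) :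
    ∃ r > 0, ∃ N : Set (Λ × (Fin (m + 1) → Bool × ℂ)), IsOpen N ∧ (τ, z) ∈ N ∧
      (∀ q ∈ N, ∀ a, ∀ p ∈ Metric.sphere (0 : ℂ) r, (q.1, q.2, p) ∈ integrandDomain l H m a) ∧
      ∀ q ∈ N, localCorr (l q.1) (H q.1) g (m + 1) q.2 =
        ∑ a : Bool, (2 * (π : ℂ) * Complex.I)⁻¹ *
          ∮ p in C(0, r), localIntegrand (l q.1) (H q.1) g m a q.2 p := by
  have h1 : ∀ᶠ q in 𝓝 ((τ, z), (0 : ℂ)), ∀ a, q.2 ≠ 0 →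
      (q.1.1, q.1.2, q.2) ∈ integrandDomain l H m a := by
    refine eventually_all.2 fun a => ?_
    have c : ContinuousAt (fun q : (Λ × (Fin (m + 1) → Bool × ℂ)) × ℂ => (q.1.1, q.1.2, q.2))
      ((τ, z), (0 : ℂ)) := by fun_prop
    exact c.tendsto.eventually (hH.eventually_mem_integrandDomain a hz)
  rw [nhds_prod_eq, eventually_prod_iff] at h1
  obtain ⟨P, hP, Q, hQ, h⟩ := h1
  obtain ⟨N, hNP, hN, hmem⟩ := eventually_nhds_iff.1 hP
  obtain ⟨ε, hε, hεQ⟩ := Metric.eventually_nhds_iff_ball.1 hQ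
  have hdom : ∀ q ∈ N, ∀ a, ∀ p ∈ Metric.ball (0 : ℂ) ε, p ≠ 0 →
      (q.1, q.2, p) ∈ integrandDomain l H m a := fun q hq a p hp => h (hNP q hq) (hεQ p hp) a
  refine ⟨ε / 2, half_pos hε, N, hN, hmem, fun q hq a p hp => hdom q hq a p ?_ ?_, fun q hq => ?_⟩
  · rw [Metric.mem_ball, Metric.mem_sphere.1 hp]
    exact half_lt_self hε
  · rintro rfl
    simp only [Metric.mem_sphere, dist_self] at hp
    exact (half_pos hε).ne hp
  · rw [localCorr_succ _ _ hgm]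
    refine Finset.sum_congr rfl fun a _ => ?_
    refine residueAt_eq_circleIntegral (half_pos hε) (half_lt_self hε) ?_
    refine differentiableOn_localIntegrand ih a q.1 (Metric.isOpen_ball.sdiff isClosed_singleton)
      (γ := fun _ => q.2) (fun i => .const _ _) (p := fun p => p) differentiableOn_id
      fun p hp => hdom q hq a p hp.1 hp.2

theorem RegularFamily.isRegularCorr_step (hH : RegularFamily l H) {g m : ℕ} (hgm : 2 ≤ 2 * g + m)
    (ih : ∀ g' k, 1 ≤ 2 * g' + k → 2 * g' + k < 2 * g + m →
      IsRegularCorr l H g' k fun l => separatedConfigurations l k) :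
    IsRegularCorr l H g m fun l => {z | ∀ i, z i ∈ regularPoints l} where
  continuousOn := by
    rintro ⟨τ, z⟩ hz
    obtain ⟨r, hr, N, hN, hmem, hdom, heq⟩ := hH.exists_circle hgm ih hz
    refine ContinuousAt.continuousWithinAt ?_
    refine ContinuousOn.continuousAt (s := N) ?_ (hN.mem_nhds hmem)
    refine ContinuousOn.congr (continuousOn_finsetSum _ fun a _ => continuousOn_const.mul
      (continuousOn_circleIntegral hr.le ?_)) heq
    exact (continuousOn_localIntegrand hH ih a).comp
      (f := fun q : (Λ × (Fin (m + 1) → Bool × ℂ)) × ℂ => (q.1.1, q.1.2, q.2)) (by fun_prop)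
      fun q hq => hdom q.1 hq.1 a q.2 hq.2
  differentiableOn := by
    intro τ U γ hU hγ hz w hw
    obtain ⟨r, hr, N, hN, hmem, hdom, heq⟩ := hH.exists_circle hgm ih (hz w hw)
    have hcont : ContinuousOn (fun w => (τ, γ w)) U :=
      continuousOn_const.prodMk (continuousOn_pi.2 fun i => (hγ i).continuousOn)
    have hV : IsOpen (U ∩ (fun w => (τ, γ w)) ⁻¹' N) := hcont.isOpen_inter_preimage hU hN
    refine DifferentiableAt.differentiableWithinAt ?_
    refine DifferentiableOn.differentiableAt (s := U ∩ (fun w => (τ, γ w)) ⁻¹' N) ?_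
      (hV.mem_nhds ⟨hw, hmem⟩)
    refine DifferentiableOn.congr (DifferentiableOn.fun_sum fun a _ =>
      (differentiableOn_const _).mul (differentiableOn_circleIntegral hV hr.le ?_ fun p hp => ?_))
      fun v hv => heq (τ, γ v) hv.2
    · refine (continuousOn_localIntegrand hH ih a).comp
        (f := fun q : ℂ × ℂ => (τ, γ q.1, q.2)) ?_ fun q hq => hdom (τ, γ q.1) hq.1.2 a q.2 hq.2
      refine continuousOn_const.prodMk (ContinuousOn.prodMk ?_ continuousOn_snd)
      exact (continuousOn_pi.2 fun i => (hγ i).continuousOn).comp continuousOn_fst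
        fun q hq => hq.1.1
    · exact differentiableOn_localIntegrand ih a τ hV
        (fun i => (hγ i).mono Set.inter_subset_left) (differentiableOn_const p)
        fun v hv => hdom (τ, γ v) hv.2 a p hp

theorem RegularFamily.isRegularCorr_separated (hH : RegularFamily l H) (g k : ℕ)
    (h : 1 ≤ 2 * g + k) : IsRegularCorr l H g k fun l => separatedConfigurations l k := by
  induction hN : 2 * g + k using Nat.strong_induction_on generalizing g k with
  | _ N ih =>
  by_cases h2 : 2 ≤ 2 * g + k
  · have := hH.isRegularCorr_step h2 fun g' k' h1 h3 => ih (2 * g' + k') (by omega) g' k' h1 rfl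
    exact ⟨this.continuousOn.mono fun q hq => hq.1,
      fun τ U γ hU hγ hz => this.differentiableOn τ U γ hU hγ fun w hw => (hz w hw).1⟩
  · obtain rfl : g = 0 := by omega
    obtain rfl : k = 1 := by omega
    exact hH.isRegularCorr_zero_two

/-- **Regularity.** In a regular family of recursions, the stable correlation functions are jointly
continuous in the parameter and the points, and holomorphic in the points. -/
theorem RegularFamily.isRegularCorr (hH : RegularFamily l H) {g m : ℕ} (h : 2 ≤ 2 * g + m) :
    IsRegularCorr l H g m fun l => {z | ∀ i, z i ∈ regularPoints l} :=
  hH.isRegularCorr_step h fun g' k h1 _ => hH.isRegularCorr_separated g' k h1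

theorem RegularFamily.eventually_differentiableAt_localIntegrand (hH : RegularFamily l H)
    {g m : ℕ} (a : Bool) (τ : Λ) {z : Fin (m + 1) → Bool × ℂ}
    (hz : ∀ i, z i ∈ regularPoints (l τ)) :
    ∀ᶠ p in 𝓝[≠] (0 : ℂ), DifferentiableAt ℂ (localIntegrand (l τ) (H τ) g m a z) p := by
  have c : Continuous fun p : ℂ => (τ, z, p) := by fun_prop
  obtain ⟨ε, hε, h⟩ := Metric.eventually_nhds_iff_ball.1
    ((c.tendsto 0).eventually (hH.eventually_mem_integrandDomain a hz))
  have hU : IsOpen (Metric.ball (0 : ℂ) ε \ {0}) := Metric.isOpen_ball.sdiff isClosed_singleton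
  have hd := differentiableOn_localIntegrand (g := g)
    (fun g' k h1 _ => hH.isRegularCorr_separated g' k h1) a τ hU
    (γ := fun _ => z) (fun i => .const _ _) differentiableOn_id fun p hp => h p hp.1 hp.2
  filter_upwards [inter_mem_nhdsWithin {(0 : ℂ)}ᶜ (Metric.ball_mem_nhds 0 hε)] with p hp
  exact hd.differentiableAt (hU.mem_nhds ⟨hp.2, hp.1⟩)

end Regularity

/-! ### Even infinite products -/

/-- The even function `∏ (1 - c_k w²)` of `w`. -/
def evenProduct (c : ℕ → ℂ) (w : ℂ) : ℂ := ∏' k, (1 - w ^ 2 * c k)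

theorem evenProduct_zero (c : ℕ → ℂ) : evenProduct c 0 = 1 := by simp [evenProduct]

theorem evenProduct_summable_bound {u : ℕ → ℝ} (hu : Summable u) (R : ℝ) {c : ℕ → ℂ}
    (hc : ∀ k, ‖c k‖ ≤ u k) {w : ℂ} (hw : ‖w‖ ≤ R) :
    Summable (fun k => R ^ 2 * u k) ∧ ∀ k, ‖-(w ^ 2 * c k)‖ ≤ R ^ 2 * u k := by
  refine ⟨hu.mul_left _, fun k => ?_⟩
  rw [norm_neg, norm_mul, norm_pow]
  exact mul_le_mul (by gcongr) (hc k) (norm_nonneg _) (sq_nonneg R)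

theorem continuousOn_evenProduct {u : ℕ → ℝ} (hu : Summable u) :
    ContinuousOn (fun q : (ℕ → ℂ) × ℂ => evenProduct q.1 q.2) {q | ∀ k, ‖q.1 k‖ ≤ u k} := by
  rintro ⟨c, w⟩ hc
  -- the coefficient sequences bounded by `u` form a compact product of discs
  let K : Set ((ℕ → ℂ) × ℂ) := (Set.univ.pi fun k => Metric.closedBall (0 : ℂ) (u k)) ×ˢ
    Metric.closedBall (0 : ℂ) (‖w‖ + 1)
  have hK : IsCompact K :=
    (isCompact_univ_pi fun k => isCompact_closedBall _ _).prod (isCompact_closedBall _ _)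
  have hKmem : ∀ q ∈ K, (∀ k, ‖q.1 k‖ ≤ u k) ∧ ‖q.2‖ ≤ ‖w‖ + 1 := fun q hq =>
    ⟨fun k => by simpa using hq.1 k trivial, by simpa using hq.2⟩
  have hunif := Summable.hasProdUniformlyOn_one_add
    (f := fun (k : ℕ) (q : (ℕ → ℂ) × ℂ) => -(q.2 ^ 2 * q.1 k)) hK
    (hu.mul_left ((‖w‖ + 1) ^ 2))
    (Eventually.of_forall fun k q hq =>
      (evenProduct_summable_bound hu _ (hKmem q hq).1 (hKmem q hq).2).2 k)
    (fun k => by fun_prop)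
  rw [hasProdUniformlyOn_iff_tendstoUniformlyOn] at hunif
  have hcont : ContinuousOn (fun q : (ℕ → ℂ) × ℂ => evenProduct q.1 q.2) K := by
    refine (hunif.continuousOn (Frequently.of_forall fun s => ?_)).congr fun q _ => ?_
    · fun_prop
    · simp only [evenProduct, sub_eq_add_neg]
  refine (hcont (c, w) ⟨fun k _ => by simpa using hc k, by simp⟩).mono_of_mem_nhdsWithin ?_
  have h2 : ∀ᶠ q : (ℕ → ℂ) × ℂ in 𝓝 (c, w), ‖q.2‖ < ‖w‖ + 1 :=
    (continuous_snd.norm.tendsto (c, w)).eventually (gt_mem_nhds (lt_add_one ‖w‖))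
  filter_upwards [self_mem_nhdsWithin, mem_nhdsWithin_of_mem_nhds h2] with q h3 h4
  exact ⟨fun k _ => by simpa using h3 k, by simpa using h4.le⟩

theorem differentiable_evenProduct {u : ℕ → ℝ} (hu : Summable u) {c : ℕ → ℂ}
    (hc : ∀ k, ‖c k‖ ≤ u k) : Differentiable ℂ (evenProduct c) := by
  intro w
  have h := Summable.hasProdLocallyUniformlyOn_one_add
    (f := fun (k : ℕ) (w : ℂ) => -(w ^ 2 * c k)) (K := Metric.ball (0 : ℂ) (‖w‖ + 1))
    Metric.isOpen_ball (hu.mul_left ((‖w‖ + 1) ^ 2))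
    (Eventually.of_forall fun k v hv =>
      (evenProduct_summable_bound hu _ hc (by simpa using (Metric.mem_ball.1 hv).le)).2 k)
    (fun k => by fun_prop)
  rw [hasProdLocallyUniformlyOn_iff_tendstoLocallyUniformlyOn] at h
  have hd : DifferentiableOn ℂ (evenProduct c) (Metric.ball (0 : ℂ) (‖w‖ + 1)) := by
    refine (h.differentiableOn (Eventually.of_forall fun s => ?_) Metric.isOpen_ball).congr
      fun v _ => ?_
    · fun_prop
    · simp only [evenProduct, sub_eq_add_neg]
  exact hd.differentiableAt (Metric.isOpen_ball.mem_nhds (by simp))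

/-- The function `(z - z⁻¹) / l` of the local coordinate `t` at the branch point `sgn a`, where
`z = sgn a + l t`. -/
def sinhCoordinate (l : ℂ) (a : Bool) (t : ℂ) : ℂ := t * (2 * sgn a + l * t) / (sgn a + l * t)

/-- The reciprocal of `ω₀₁(z) - ω₀₁(σ(z))`, up to a power of `l`, for `x = z + z⁻¹` and
`y = (1/2) (z - z⁻¹) ∏ (1 - c_k (z - z⁻¹)² / l²)`. -/
def productWeight (l : ℂ) (c : ℕ → ℂ) (a : Bool) (t : ℂ) : ℂ :=
  (sgn a + l * t) / (sinhCoordinate l a t ^ 2 * evenProduct c (sinhCoordinate l a t))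

theorem regularFamily_productWeight {Λ : Type*} [TopologicalSpace Λ] {l : Λ → ℂ}
    (hl : Continuous l) {c : Λ → ℕ → ℂ} (hc : ∀ k, Continuous fun τ => c τ k) {u : ℕ → ℝ}
    (hu : Summable u) (hcu : ∀ τ k, ‖c τ k‖ ≤ u k) :
    RegularFamily l fun τ => productWeight (l τ) (c τ) where
  continuous_scale := hl
  regular := by
    intro τ a
    have hP : Continuous fun q : Λ × ℂ => evenProduct (c q.1) q.2 :=
      (continuousOn_evenProduct hu).comp_continuous (f := fun q : Λ × ℂ => (c q.1, q.2))
        (Continuous.prodMk (continuous_pi fun k => (hc k).comp continuous_fst) continuous_snd)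
        fun q => hcu q.1
    have hS : ∀ q : Λ × ℂ, sgn a + l q.1 * q.2 ≠ 0 →
        ContinuousAt (fun q : Λ × ℂ => sinhCoordinate (l q.1) a q.2) q := fun q hq => by
      unfold sinhCoordinate
      exact ContinuousAt.div (by fun_prop) (by fun_prop) hq
    have hPS : ∀ q : Λ × ℂ, sgn a + l q.1 * q.2 ≠ 0 → ContinuousAt (fun q : Λ × ℂ =>
        evenProduct (c q.1) (sinhCoordinate (l q.1) a q.2)) q := fun q hq =>
      hP.continuousAt.comp (f := fun q : Λ × ℂ => (q.1, sinhCoordinate (l q.1) a q.2))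
        (continuousAt_fst.prodMk (hS q hq))
    have e1 : ∀ᶠ q in 𝓝 (τ, (0 : ℂ)), sgn a + l q.1 * q.2 ≠ 0 :=
      ContinuousAt.eventually_ne (by fun_prop) (by simp [sgn_ne_zero])
    have e2 : ∀ᶠ q in 𝓝 (τ, (0 : ℂ)), 2 * sgn a + l q.1 * q.2 ≠ 0 :=
      ContinuousAt.eventually_ne (by fun_prop) (by simp [sgn_ne_zero])
    have e3 : ∀ᶠ q in 𝓝 (τ, (0 : ℂ)),
        evenProduct (c q.1) (sinhCoordinate (l q.1) a q.2) ≠ 0 :=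
      (hPS (τ, 0) (by simp [sgn_ne_zero])).eventually_ne
        (by simp [sinhCoordinate, evenProduct_zero])
    filter_upwards [e1, e2, e3] with q h1 h2 h3 h0
    have h4 : sinhCoordinate (l q.1) a q.2 ^ 2 *
        evenProduct (c q.1) (sinhCoordinate (l q.1) a q.2) ≠ 0 :=
      mul_ne_zero (pow_ne_zero 2 (div_ne_zero (mul_ne_zero h0 h2) h1)) h3
    constructor
    · unfold productWeight
      exact ContinuousAt.div (by fun_prop) (((hS q h1).pow 2).mul (hPS q h1)) h4
    · have hd : DifferentiableAt ℂ (sinhCoordinate (l q.1) a) q.2 := by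
        unfold sinhCoordinate
        exact DifferentiableAt.div (by fun_prop) (by fun_prop) h1
      unfold productWeight
      refine DifferentiableAt.div (by fun_prop) ((hd.pow 2).mul ?_) h4
      exact (differentiable_evenProduct hu (hcu q.1)).differentiableAt.comp q.2 hd

/-! ### From spectral curves to local coordinates -/

theorem integral_omega02_segment {z₁ z w : ℂ} (h : z₁ ∉ segment ℝ z w) :
    (∫ s in (0 : ℝ)..1, RationalSpectralCurve.omega02 z₁ (z + (s : ℂ) * (w - z)) * (w - z)) =
      1 / (z₁ - w) - 1 / (z₁ - z) := by
  have hne : ∀ s ∈ Set.uIcc (0 : ℝ) 1, z₁ - (z + (s : ℂ) * (w - z)) ≠ 0 := by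
    intro s hs h0
    rw [Set.uIcc_of_le zero_le_one] at hs
    refine h ?_
    rw [segment_eq_image']
    exact ⟨s, hs, by simpa using (sub_eq_zero.1 h0).symm⟩
  have hder : ∀ s ∈ Set.uIcc (0 : ℝ) 1,
      HasDerivAt (fun s : ℝ => (z₁ - (z + (s : ℂ) * (w - z)))⁻¹)
        (RationalSpectralCurve.omega02 z₁ (z + (s : ℂ) * (w - z)) * (w - z)) s := by
    intro s hs
    have h1 : HasDerivAt (fun s : ℝ => z₁ - (z + (s : ℂ) * (w - z))) (-(1 * (w - z))) s :=
      (((Complex.ofRealCLM.hasDerivAt (x := s)).mul_const (w - z)).const_add z).const_sub z₁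
    convert! h1.inv (hne s hs) using 1
    simp only [RationalSpectralCurve.omega02]
    ring
  rw [intervalIntegral.integral_eq_sub_of_hasDerivAt hder]
  · simp
  · refine ContinuousOn.intervalIntegrable ?_
    simp only [RationalSpectralCurve.omega02]
    exact (ContinuousOn.div (by fun_prop) (by fun_prop)
      fun s hs => pow_ne_zero 2 (hne s hs)).mul continuousOn_const

theorem RationalSpectralCurve.eventually_kernel_eq (C : RationalSpectralCurve) {α z₁ : ℂ}
    (hα : α ∈ branchPoints C.x) (hz₁ : z₁ ≠ α) :
    ∀ᶠ p in 𝓝 α, C.kernel α z₁ p = (1 / 2) * (1 / (z₁ - C.σ α p) - 1 / (z₁ - p)) /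
      (C.omega01 p - C.omega01 (C.σ α p) * deriv (C.σ α) p) := by
  have hσ : Tendsto (C.σ α) (𝓝 α) (𝓝 α) := by
    simpa only [C.σ_fixed α hα] using (C.analyticAt_σ α hα).continuousAt.tendsto
  have hball : Metric.ball α (dist z₁ α) ∈ 𝓝 α := Metric.ball_mem_nhds _ (dist_pos.2 hz₁)
  filter_upwards [hball, hσ hball] with p h1 h2
  rw [kernel, integral_omega02_segment]
  exact fun h => lt_irrefl _ (Metric.mem_ball.1 ((convex_ball α _).segment_subset h1 h2 h))

theorem bracket_eq_smul {X Y : Type*} {V : (g n : ℕ) → (Fin n → X) → ℂ}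
    {W : (g n : ℕ) → (Fin n → Y) → ℂ} {c u : ℂ} {pos : X → Y} {D : Set X} {g m : ℕ}
    (hgm : 2 ≤ 2 * g + m)
    (ih : ∀ g' k, 1 ≤ 2 * g' + k → 2 * g' + k < 2 * g + m → ∀ z : Fin (k + 1) → X,
      (∀ i, z i ∈ D) →
      V g' (k + 1) z = c ^ (2 * g' + k - 1) * u ^ (k + 1) * W g' (k + 1) (pos ∘ z))
    {x y : X} {z : Fin m → X} (hx : x ∈ D) (hy : y ∈ D) (hz : ∀ i, z i ∈ D) :
    bracket V g m x y z =
      c ^ (2 * g + m - 2) * u ^ (m + 2) * bracket W g m (pos x) (pos y) (pos ∘ z) := by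
  unfold bracket
  rw [mul_add, Finset.mul_sum]
  congr 1
  · split_ifs with h
    · rw [ih (g - 1) (m + 1) (by omega) (by omega) _ (Fin.cases hx (Fin.cases hy hz)),
        show 2 * (g - 1) + (m + 1) - 1 = 2 * g + m - 2 by omega, Fin.comp_cons, Fin.comp_cons]
    · rw [mul_zero]
  · refine Finset.sum_congr rfl fun g₁ _ => ?_
    rw [Finset.mul_sum]
    refine Finset.sum_congr rfl fun I _ => ?_
    have h1 := I.card_add_card_compl
    rw [Fintype.card_fin] at h1
    have h2 := g₁.isLt
    split_ifs with h
    · rw [ih _ _ (by omega) (by omega) _ (Fin.cases hx fun i => by simpa using hz _),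
        ih _ _ (by omega) (by omega) _ (Fin.cases hy fun i => by simpa using hz _),
        Fin.comp_cons, Fin.comp_cons,
        show 2 * g + m - 2 = (2 * g₁.val + I.card - 1) + (2 * (g - g₁.val) + Iᶜ.card - 1) by omega,
        show m + 2 = (I.card + 1) + (Iᶜ.card + 1) by omega, pow_add, pow_add]
      simp only [Function.comp_def]
      ring
    · rw [mul_zero]

theorem RationalSpectralCurve.corr_zero_two (C : RationalSpectralCurve) (z : Fin 2 → ℂ) :
    C.corr 0 2 z = omega02 (z 0) (z 1) := by
  rw [RationalSpectralCurve.corr]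

/-- Rescaling the differentials `ω_{g,n}` by `c ^ (2g - 2 + n)` multiplies the recursion kernel by
`c`. The hypothesis `hstep` compares one step of the two recursions, for arbitrary integrands `F` and
`F'` in place of the bracket. -/
theorem RationalSpectralCurve.scaled_corr_eq_localCorr (C : RationalSpectralCurve) {l : ℂ}
    {H : Bool → ℂ → ℂ} {pos : Bool × ℂ → ℂ} {D : Set (Bool × ℂ)} {c u : ℂ} (hc : c ≠ 0) (hu : u ≠ 0)
    (hB : ∀ x ∈ D, ∀ y ∈ D, u ^ 2 * omega02 (pos x) (pos y) = cauchyKernel l x y ^ 2)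
    (hstep : ∀ (κ : ℂ) (F : ℂ → ℂ → ℂ) (F' : Bool × ℂ → Bool × ℂ → ℂ), κ ≠ 0 →
      (∀ x ∈ D, ∀ y ∈ D, F' x y = κ * u ^ 2 * F (pos x) (pos y)) → ∀ x ∈ D,
      (∀ a, ∀ᶠ p in 𝓝[≠] (0 : ℂ), DifferentiableAt ℂ
        (fun p => localKernel l H a x p * F' (a, p) (a, localInvolution l a p)) p) →
      c * κ * u * (∑ᶠ α ∈ branchPoints C.x, residueAt (fun p =>
          C.kernel α (pos x) p * deriv (C.σ α) p * F p (C.σ α p)) α) =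
        ∑ a : Bool, residueAt (fun p =>
          localKernel l H a x p * F' (a, p) (a, localInvolution l a p)) 0)
    (hdiff : ∀ (g m : ℕ) (a : Bool) (z : Fin (m + 1) → Bool × ℂ), (∀ i, z i ∈ D) →
      ∀ᶠ p in 𝓝[≠] (0 : ℂ), DifferentiableAt ℂ (localIntegrand l H g m a z) p)
    (g k : ℕ) (h : 1 ≤ 2 * g + k) (z : Fin (k + 1) → Bool × ℂ) (hz : ∀ i, z i ∈ D) :
    localCorr l H g (k + 1) z =
      c ^ (2 * g + k - 1) * u ^ (k + 1) * C.corr g (k + 1) (pos ∘ z) := by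
  induction hN : 2 * g + k using Nat.strong_induction_on generalizing g k with
  | _ N ih =>
  subst hN
  by_cases h2 : 2 ≤ 2 * g + k
  · rw [localCorr_succ _ _ h2, C.corr_succ h2]
    have key := hstep (c ^ (2 * g + k - 2) * u ^ k)
      (fun p q => bracket C.corr g k p q fun i => (pos ∘ z) i.succ)
      (fun x y => bracket (localCorr l H) g k x y fun i => z i.succ)
      (mul_ne_zero (pow_ne_zero _ hc) (pow_ne_zero _ hu)) (fun x hx y hy => ?_) (z 0) (hz 0)
      (fun a => hdiff g k a z hz)
    · refine key.symm.trans ?_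
      rw [show 2 * g + k - 1 = (2 * g + k - 2) + 1 by omega, pow_succ, pow_succ,
        Function.comp_apply]
      ring
    · rw [bracket_eq_smul h2 (fun g' k' h1 h3 z' hz' => ih _ h3 g' k' h1 z' hz' rfl) hx hy
        (fun i => hz i.succ), pow_add, mul_assoc (c ^ _) (u ^ k)]
      rfl
  · obtain rfl : g = 0 := by omega
    obtain rfl : k = 1 := by omega
    rw [localCorr_zero_two, ← hB _ (hz 0) _ (hz 1),
      show C.corr 0 (1 + 1) (pos ∘ z) = _ from C.corr_zero_two (pos ∘ z)]
    simp

theorem position_ne_sgn {l : ℂ} (hl : l ≠ 0) {x : Bool × ℂ} (hx : x ∈ regularPoints l)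
    (a : Bool) : position l x ≠ sgn a := by
  rcases x with ⟨b, t⟩
  obtain ⟨h1, h2⟩ := hx
  intro h
  simp only [position] at h
  by_cases hab : b = a
  · subst hab
    exact mul_ne_zero hl h1 (by linear_combination h)
  · have := sgn_sub_of_ne hab
    exact h2 (by linear_combination h - this)

theorem cauchyKernel_eq_of_ne_zero {l : ℂ} (hl : l ≠ 0) (x y : Bool × ℂ) :
    cauchyKernel l x y = l / (position l x - position l y) := by
  rcases x with ⟨a, s⟩
  rcases y with ⟨b, t⟩
  by_cases h : a = b
  · subst h
    simp only [cauchyKernel, separation, position, if_true]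
    rw [show sgn a + l * s - (sgn a + l * t) = l * (s - t) by ring, div_mul_eq_div_div, div_self hl]
  · simp only [cauchyKernel, separation, position, if_neg h]
    congr 1
    ring

theorem position_localInvolution {l : ℂ} {a : Bool} {t : ℂ} (h : sgn a + l * t ≠ 0) :
    position l (a, localInvolution l a t) = (sgn a + l * t)⁻¹ := by
  have h2 : 1 + sgn a * l * t ≠ 0 := by
    rw [show 1 + sgn a * l * t = sgn a * (sgn a + l * t) by
      linear_combination -sgn_mul_self a]
    exact mul_ne_zero (sgn_ne_zero a) h
  simp only [position, localInvolution]
  field_simp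
  linear_combination (1 + sgn a * l * t + l ^ 2 * t ^ 2) * sgn_mul_self a

theorem sum_branchPoints_joukowsky (f : ℂ → ℂ) :
    (∑ᶠ α ∈ branchPoints (fun z : ℂ => z + z⁻¹), f α) = ∑ a : Bool, f (sgn a) := by
  rw [branchPoints_joukowsky, finsum_mem_pair (by norm_num), Fintype.sum_bool]
  rfl

theorem sgn_mem_branchPoints_joukowsky (a : Bool) :
    sgn a ∈ branchPoints (fun z : ℂ => z + z⁻¹) := by
  rw [branchPoints_joukowsky]
  cases a <;> simp

/-- The rescaled correlation functions of a curve with `x = z + z⁻¹`, in local coordinates. -/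
theorem joukowskyCurve_corr {y : ℂ → ℂ} {l : ℝ} (hl : 0 < l) {c : ℂ} (hc : c ≠ 0)
    {H : Bool → ℂ → ℂ}
    (hH : ∀ a, ∀ᶠ t in 𝓝[≠] (0 : ℂ), H a t = c / (l * ((joukowskyCurve y).omega01 (sgn a + l * t) -
      (joukowskyCurve y).omega01 (sgn a + l * t)⁻¹ * -((sgn a + l * t) ^ 2)⁻¹)))
    (hdiff : ∀ (g m : ℕ) (a : Bool) (z : Fin (m + 1) → Bool × ℂ), (∀ i, z i ∈ regularPoints l) →
      ∀ᶠ p in 𝓝[≠] (0 : ℂ), DifferentiableAt ℂ (localIntegrand l H g m a z) p)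
    {g k : ℕ} (h : 1 ≤ 2 * g + k) {z : Fin (k + 1) → Bool × ℂ} (hz : ∀ i, z i ∈ regularPoints l) :
    localCorr l H g (k + 1) z =
      c ^ (2 * g + k - 1) * (l : ℂ) ^ (k + 1) * (joukowskyCurve y).corr g (k + 1)
        (position l ∘ z) := by
  have hl' : (l : ℂ) ≠ 0 := Complex.ofReal_ne_zero.2 hl.ne'
  refine RationalSpectralCurve.scaled_corr_eq_localCorr (joukowskyCurve y) hc hl' ?_ ?_ hdiff g k h
    z hz
  · intro x _ y _
    rw [cauchyKernel_eq_of_ne_zero hl', RationalSpectralCurve.omega02, div_pow, mul_one_div]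
  · intro κ F F' hκ hF x hx hd
    have hsum := sum_branchPoints_joukowsky fun α => residueAt (fun p =>
      (joukowskyCurve y).kernel α (position l x) p * deriv ((joukowskyCurve y).σ α) p *
        F p ((joukowskyCurve y).σ α p)) α
    have hx' : (joukowskyCurve y).x = fun z => z + z⁻¹ := rfl
    rw [hx', hsum, Finset.mul_sum]
    refine Finset.sum_congr rfl fun a _ => ?_
    have hconst : c * κ * l ≠ 0 := mul_ne_zero (mul_ne_zero hc hκ) hl'
    rw [← residueAt_comp_affine _ (sgn a) hl, eq_comm, ← inv_mul_eq_iff_eq_mul₀ hconst,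
      ← residueAt_const_mul _ (hd a)]
    refine residueAt_congr ?_
    have htend : Tendsto (fun t : ℂ => sgn a + l * t) (𝓝[≠] 0) (𝓝 (sgn a)) := by
      have : Continuous fun t : ℂ => sgn a + l * t := by fun_prop
      simpa using (this.tendsto 0).mono_left nhdsWithin_le_nhds
    have e1 := htend.eventually ((joukowskyCurve y).eventually_kernel_eq
      (sgn_mem_branchPoints_joukowsky a) (position_ne_sgn hl' hx a))
    have e2 := htend.eventually (isOpen_ne.mem_nhds (sgn_ne_zero a))
    have e3 : ∀ᶠ t in 𝓝[≠] (0 : ℂ), 2 * sgn a + l * t ≠ 0 := by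
      refine mem_nhdsWithin_of_mem_nhds (ContinuousAt.eventually_ne (y := 0) (by fun_prop) ?_)
      simp [sgn_ne_zero]
    filter_upwards [e1, e2, e3, hH a, self_mem_nhdsWithin] with t h1 h2 h3 h4 h5
    have h2' : sgn a + l * t ≠ 0 := h2
    have h6 : 1 + sgn a * l * t = sgn a * (sgn a + l * t) := by
      linear_combination -sgn_mul_self a
    have h6' : 1 + sgn a * l * t ≠ 0 := h6 ▸ mul_ne_zero (sgn_ne_zero a) h2'
    have h7 : (1 + sgn a * l * t) ^ 2 = (sgn a + l * t) ^ 2 := by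
      rw [h6]
      linear_combination (sgn a + l * t) ^ 2 * sgn_mul_self a
    have hm1 : (a, t) ∈ regularPoints (l : ℂ) := ⟨h5, h3⟩
    have hm2 : (a, localInvolution l a t) ∈ regularPoints (l : ℂ) := by
      refine ⟨localInvolution_ne_zero h5 h6', ?_⟩
      have : 2 * sgn a + l * localInvolution l a t =
          sgn a * (2 * sgn a + l * t) / (1 + sgn a * l * t) * sgn a := by
        simp only [localInvolution]
        field_simp
        linear_combination (l * t - 2 * sgn a) * sgn_mul_self a
      rw [this]
      exact mul_ne_zero (div_ne_zero (mul_ne_zero (sgn_ne_zero a) h3) h6') (sgn_ne_zero a)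
    have hσ : (joukowskyCurve y).σ (sgn a) = fun z => z⁻¹ := rfl
    rw [hF _ hm1 _ hm2, h1, localKernel, cauchyKernel_eq_of_ne_zero hl',
      cauchyKernel_eq_of_ne_zero hl', position_localInvolution h2', h4, h7, hσ]
    simp only [deriv_inv]
    rw [show position l (a, t) = sgn a + l * t from rfl]
    generalize (joukowskyCurve y).omega01 (sgn a + l * t) -
      (joukowskyCurve y).omega01 (sgn a + l * t)⁻¹ * -((sgn a + l * t) ^ 2)⁻¹ = Δ
    generalize (position l x - (sgn a + l * t)⁻¹) = A
    generalize (position l x - (sgn a + l * t)) = B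
    field_simp

/-- The rescaled correlation functions of a curve with `x = t² / 2` are those of the decoupled
recursion `l = 0`, at points on the copy of `ℂ` with label `true`. -/
theorem halfSquareCurve_corr {y : ℂ → ℂ} {c : ℂ} (hc : c ≠ 0) {H : Bool → ℂ → ℂ}
    (hH : ∀ᶠ t in 𝓝[≠] (0 : ℂ), H true t = c / ((halfSquareCurve y).omega01 t +
      (halfSquareCurve y).omega01 (-t)))
    (hdiff : ∀ (g m : ℕ) (a : Bool) (z : Fin (m + 1) → Bool × ℂ), (∀ i, z i ∈ regularPoints 0) →
      ∀ᶠ p in 𝓝[≠] (0 : ℂ), DifferentiableAt ℂ (localIntegrand 0 H g m a z) p)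
    {g k : ℕ} (h : 1 ≤ 2 * g + k) {t : Fin (k + 1) → ℂ} (ht : ∀ i, t i ≠ 0) :
    localCorr 0 H g (k + 1) (fun i => (true, t i)) =
      c ^ (2 * g + k - 1) * (halfSquareCurve y).corr g (k + 1) t := by
  have key := RationalSpectralCurve.scaled_corr_eq_localCorr (halfSquareCurve y) (l := 0) (H := H)
    (pos := fun x => x.2) (D := {x | x.1 = true ∧ x.2 ≠ 0}) hc one_ne_zero ?_ ?_
    (fun g m a z hz => hdiff g m a z fun i => ⟨(hz i).2, by simp [sgn_ne_zero]⟩) g k h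
    (fun i => (true, t i)) fun i => ⟨rfl, ht i⟩
  · rw [key, one_pow, mul_one]
    rfl
  · rintro ⟨a, s⟩ ⟨rfl, -⟩ ⟨b, t⟩ ⟨rfl, -⟩
    simp [RationalSpectralCurve.omega02, cauchyKernel, separation]
  · rintro κ F F' hκ hF ⟨b, s⟩ ⟨rfl, hs⟩ hd
    have hx' : (halfSquareCurve y).x = fun t => t ^ 2 / 2 := rfl
    -- the branch point with label `false` does not contribute
    have hfalse : residueAt (fun p => localKernel 0 H false (true, s) p *
        F' (false, p) (false, localInvolution 0 false p)) 0 = 0 := by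
      refine (residueAt_congr (Eventually.of_forall fun p => ?_)).trans (residueAt_zero_fun 0)
      simp [localKernel, cauchyKernel]
    rw [hx', branchPoints_half_sq, finsum_mem_singleton, Fintype.sum_bool, hfalse, add_zero, mul_one]
    rw [eq_comm, ← inv_mul_eq_iff_eq_mul₀ (mul_ne_zero hc hκ), ← residueAt_const_mul _ (hd true)]
    refine residueAt_congr ?_
    have e1 := (halfSquareCurve y).eventually_kernel_eq (α := 0) (z₁ := s)
      (by rw [hx', branchPoints_half_sq]; exact Set.mem_singleton _) hs
    filter_upwards [mem_nhdsWithin_of_mem_nhds e1, hH, self_mem_nhdsWithin] with t h1 h4 h5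
    have hinv : localInvolution 0 true t = -t := by simp [localInvolution]
    have hσ : (halfSquareCurve y).σ 0 = fun z => -z := rfl
    rw [hinv, hF (true, t) ⟨rfl, h5⟩ (true, -t) ⟨rfl, neg_ne_zero.2 h5⟩, h1, localKernel, h4, hinv,
      hσ]
    simp only [cauchyKernel, separation, deriv_neg, if_true]
    rw [show (halfSquareCurve y).omega01 t - (halfSquareCurve y).omega01 (-t) * -1 =
      (halfSquareCurve y).omega01 t + (halfSquareCurve y).omega01 (-t) by ring]
    generalize (halfSquareCurve y).omega01 t + (halfSquareCurve y).omega01 (-t) = Δ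
    field_simp
    simp

/-! ### Growth at the branch point and dependence on finite jets -/

/-- `f` grows at most polynomially in `1 / ρ` on `S`. -/
def ModerateGrowth {T : Type*} (S : Set T) (ρ : T → ℝ) (f : T → ℂ) : Prop :=
  ∃ (C : ℝ) (N : ℕ), 0 ≤ C ∧ ∀ s ∈ S, ‖f s‖ ≤ C * (ρ s)⁻¹ ^ N

namespace ModerateGrowth

variable {T T' : Type*} {S : Set T} {S' : Set T'} {ρ : T → ℝ} {ρ' : T' → ℝ} {f f' : T → ℂ}

theorem const (S : Set T) (ρ : T → ℝ) (c : ℂ) : ModerateGrowth S ρ fun _ => c :=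
  ⟨‖c‖, 0, norm_nonneg c, fun _ _ => by simp⟩

theorem mul (hρ : ∀ s ∈ S, 0 < ρ s) (hf : ModerateGrowth S ρ f) (hf' : ModerateGrowth S ρ f') :
    ModerateGrowth S ρ fun s => f s * f' s := by
  obtain ⟨C, N, hC, h⟩ := hf
  obtain ⟨C', N', hC', h'⟩ := hf'
  refine ⟨C * C', N + N', mul_nonneg hC hC', fun s hs => ?_⟩
  have := hρ s hs
  calc ‖f s * f' s‖ = ‖f s‖ * ‖f' s‖ := norm_mul _ _
    _ ≤ (C * (ρ s)⁻¹ ^ N) * (C' * (ρ s)⁻¹ ^ N') :=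
        mul_le_mul (h s hs) (h' s hs) (norm_nonneg _) (by positivity)
    _ = C * C' * (ρ s)⁻¹ ^ (N + N') := by rw [pow_add]; ring

theorem add (hρ : ∀ s ∈ S, 0 < ρ s) (hρ1 : ∀ s ∈ S, ρ s ≤ 1) (hf : ModerateGrowth S ρ f)
    (hf' : ModerateGrowth S ρ f') : ModerateGrowth S ρ fun s => f s + f' s := by
  obtain ⟨C, N, hC, h⟩ := hf
  obtain ⟨C', N', hC', h'⟩ := hf'
  refine ⟨C + C', N + N', add_nonneg hC hC', fun s hs => ?_⟩
  have h1 : 1 ≤ (ρ s)⁻¹ := (one_le_inv₀ (hρ s hs)).2 (hρ1 s hs)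
  calc ‖f s + f' s‖ ≤ ‖f s‖ + ‖f' s‖ := norm_add_le _ _
    _ ≤ C * (ρ s)⁻¹ ^ N + C' * (ρ s)⁻¹ ^ N' := add_le_add (h s hs) (h' s hs)
    _ ≤ C * (ρ s)⁻¹ ^ (N + N') + C' * (ρ s)⁻¹ ^ (N + N') := by
        gcongr <;> first | exact h1 | omega
    _ = (C + C') * (ρ s)⁻¹ ^ (N + N') := by ring

theorem comp {F : T' → ℂ} (hF : ModerateGrowth S' ρ' F) {e : T → T'}
    (he : ∀ s ∈ S, e s ∈ S') (heρ : ∀ s ∈ S, ρ' (e s) = ρ s / 2) :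
    ModerateGrowth S ρ fun s => F (e s) := by
  obtain ⟨C, N, hC, h⟩ := hF
  refine ⟨C * 2 ^ N, N, by positivity, fun s hs => (h _ (he s hs)).trans_eq ?_⟩
  rw [heρ s hs, inv_div, div_eq_mul_inv, mul_pow, mul_assoc]

end ModerateGrowth

theorem RegularFamily.of_eventually_differentiableAt {H : Bool → ℂ → ℂ}
    (h : ∀ a, ∀ᶠ p in 𝓝[≠] (0 : ℂ), DifferentiableAt ℂ (H a) p) :
    RegularFamily (fun _ : Unit => (0 : ℂ)) (fun _ => H) where
  continuous_scale := continuous_const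
  regular := by
    intro τ a
    have h1 := eventually_nhdsWithin_iff.1 (h a)
    filter_upwards [(continuous_snd.tendsto (τ, (0 : ℂ))).eventually h1] with q h2 h3
    exact ⟨(h2 h3).continuousAt.comp continuousAt_snd, h2 h3⟩

theorem localInvolution_zero (a : Bool) (p : ℂ) : localInvolution 0 a p = -p := by
  simp [localInvolution]

/-- For `l = 0` the branch point with label `false` does not interact with points that have the
label `true`. -/
theorem localIntegrand_false {H : Bool → ℂ → ℂ} {g m : ℕ} {z : Fin (m + 1) → Bool × ℂ}
    (hz : (z 0).1 = true) : localIntegrand 0 H g m false z = fun _ => 0 := by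
  funext p
  simp [localIntegrand, localKernel, cauchyKernel, hz]

theorem localCorr_succ_of_label_true {H : Bool → ℂ → ℂ} {g m : ℕ} (h : 2 ≤ 2 * g + m)
    {z : Fin (m + 1) → Bool × ℂ} (hz : (z 0).1 = true) :
    localCorr 0 H g (m + 1) z = residueAt (localIntegrand 0 H g m true z) 0 := by
  rw [localCorr_succ _ _ h, Fintype.sum_bool, localIntegrand_false hz, residueAt_zero_fun, add_zero]

/-- Configurations of points on the copy of `ℂ` with label `true`, at distance at least `ρ` from the
branch point, with the first point at distance at least `ρ` from the others. -/
def spreadConfigurations (ε : ℝ) (k : ℕ) : Set (ℝ × (Fin (k + 1) → Bool × ℂ)) :=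
  {q | 0 < q.1 ∧ q.1 ≤ ε ∧ (∀ i, (q.2 i).1 = true ∧ q.1 ≤ ‖(q.2 i).2‖) ∧
    ∀ i : Fin k, q.1 ≤ ‖(q.2 0).2 - (q.2 i.succ).2‖}

/-- Configurations at distance at least `ρ` from the branch point, together with a point of the
circle of radius `ρ / 2`. -/
def circleConfigurations (ε : ℝ) (m : ℕ) : Set (ℝ × (Fin (m + 1) → Bool × ℂ) × ℂ) :=
  {q | 0 < q.1 ∧ q.1 ≤ ε ∧ (∀ i, (q.2.1 i).1 = true ∧ q.1 ≤ ‖(q.2.1 i).2‖) ∧ ‖q.2.2‖ = q.1 / 2}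

theorem half_le_norm_sub {ρ : ℝ} {s p : ℂ} (hs : ρ ≤ ‖s‖) (hp : ‖p‖ = ρ / 2) :
    ρ / 2 ≤ ‖s - p‖ := by
  linarith [norm_sub_norm_le s p]

theorem moderateGrowth_cauchyKernel {ε : ℝ} {m : ℕ} (i : Fin (m + 1))
    {f : ℂ → ℂ} (hf : ∀ p, ‖f p‖ = ‖p‖) :
    ModerateGrowth (circleConfigurations ε m) Prod.fst
      fun q => cauchyKernel 0 (q.2.1 i) (true, f q.2.2) := by
  refine ⟨2, 1, zero_le_two, fun q hq => ?_⟩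
  obtain ⟨h1, h2, h3, h4⟩ := hq
  simp only [cauchyKernel, separation, (h3 i).1, if_true]
  rw [norm_div, norm_one, pow_one,
    ← div_eq_mul_inv, show 2 / q.1 = 1 / (q.1 / 2) by field_simp]
  exact one_div_le_one_div_of_le (half_pos h1)
    (half_le_norm_sub (h3 i).2 ((hf _).trans h4))

/-- A bound for the bracket on the circle of radius `ρ / 2`: all its arguments keep the distance
`ρ / 2` from the branch point, and those on the circle keep it from the remaining ones. -/
theorem moderateGrowth_bracket {H : Bool → ℂ → ℂ} {ε : ℝ} (hε1 : ε ≤ 1) {g m : ℕ}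
    (ih : ∀ g' k, 1 ≤ 2 * g' + k → 2 * g' + k < 2 * g + m →
      ModerateGrowth (spreadConfigurations ε k) Prod.fst
        fun q => localCorr 0 H g' (k + 1) q.2) :
    ModerateGrowth (circleConfigurations ε m) Prod.fst fun q =>
      bracket (localCorr 0 H) g m (true, q.2.2) (true, localInvolution 0 true q.2.2)
        fun i => q.2.1 i.succ := by
  have hpos : ∀ q ∈ circleConfigurations ε m, 0 < q.1 := fun q hq => hq.1
  have hle : ∀ q ∈ circleConfigurations ε m, q.1 ≤ 1 := fun q hq => hq.2.1.trans hε1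
  simp only [localInvolution_zero]
  refine bracket_induction (V := fun _ => localCorr 0 H)
    (ModerateGrowth (circleConfigurations ε m) Prod.fst) (.const _ _ 0)
    (fun f f' hf hf' => hf.add hpos hle hf') (fun f f' hf hf' => hf.mul hpos hf') ?_ ?_ ?_
  · intro hg
    refine (ih (g - 1) (m + 1) (by omega) (by omega)).comp (T := ℝ × (Fin (m + 1) → Bool × ℂ) × ℂ)
      (e := fun q => (q.1 / 2,
      (Fin.cons (true, q.2.2) (Fin.cons (true, -q.2.2) fun i : Fin m => q.2.1 i.succ) :
        Fin (m + 1 + 1) → Bool × ℂ))) ?_ fun q _ => rfl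
    rintro ⟨ρ, z, p⟩ ⟨h1, h2, h3, h4⟩
    simp only at h1 h2 h3 h4
    refine ⟨half_pos h1, (half_le_self h1.le).trans h2, ?_, ?_⟩
    · refine Fin.cases ⟨rfl, h4.ge⟩ (Fin.cases ⟨rfl, ?_⟩ fun i => ?_)
      · simpa using h4.ge
      · simpa using ⟨(h3 i.succ).1, (half_le_self h1.le).trans (h3 i.succ).2⟩
    · refine Fin.cases ?_ fun i => ?_
      · simp only [Fin.cons_zero, Fin.cons_succ]
        rw [show p - -p = 2 * p by ring, norm_mul, h4, Complex.norm_ofNat]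
        linarith
      · simp only [Fin.cons_zero, Fin.cons_succ]
        rw [norm_sub_rev]
        exact half_le_norm_sub (h3 _).2 h4
  · intro g' k e hk1 hk2
    refine (ih g' k hk1 hk2).comp (T := ℝ × (Fin (m + 1) → Bool × ℂ) × ℂ)
      (e := fun q => (q.1 / 2,
      (Fin.cons (true, q.2.2) (fun i => q.2.1 (e i).succ) : Fin (k + 1) → Bool × ℂ))) ?_
        fun q _ => rfl
    rintro ⟨ρ, z, p⟩ ⟨h1, h2, h3, h4⟩
    simp only at h1 h2 h3 h4
    refine ⟨half_pos h1, (half_le_self h1.le).trans h2, ?_, fun i => ?_⟩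
    · refine Fin.cases ⟨rfl, h4.ge⟩ fun i => ?_
      simpa using ⟨(h3 (e i).succ).1, (half_le_self h1.le).trans (h3 (e i).succ).2⟩
    · simp only [Fin.cons_zero, Fin.cons_succ]
      rw [norm_sub_rev]
      exact half_le_norm_sub (h3 _).2 h4
  · intro g' k e hk1 hk2
    refine (ih g' k hk1 hk2).comp (T := ℝ × (Fin (m + 1) → Bool × ℂ) × ℂ)
      (e := fun q => (q.1 / 2,
      (Fin.cons (true, -q.2.2) (fun i => q.2.1 (e i).succ) : Fin (k + 1) → Bool × ℂ))) ?_
        fun q _ => rfl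
    rintro ⟨ρ, z, p⟩ ⟨h1, h2, h3, h4⟩
    simp only at h1 h2 h3 h4
    refine ⟨half_pos h1, (half_le_self h1.le).trans h2, ?_, fun i => ?_⟩
    · refine Fin.cases ⟨rfl, ?_⟩ fun i => ?_
      · simpa using h4.ge
      · simpa using ⟨(h3 (e i).succ).1, (half_le_self h1.le).trans (h3 (e i).succ).2⟩
    · simp only [Fin.cons_zero, Fin.cons_succ]
      rw [norm_sub_rev]
      exact half_le_norm_sub (h3 _).2 ((norm_neg p).trans h4)

/-- The correlation functions of the decoupled recursion have poles of bounded order at the branch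
point, uniformly in all their arguments. -/
theorem moderateGrowth_localCorr {H : Bool → ℂ → ℂ} {ε : ℝ} (hε : 0 < ε) (hε1 : ε ≤ 1)
    (hd : ∀ a p, p ≠ 0 → ‖p‖ < ε → DifferentiableAt ℂ (H a) p)
    {A : ℝ} (hA : 0 ≤ A) {B : ℕ} (hHB : ∀ p, p ≠ 0 → ‖p‖ < ε → ‖H true p‖ ≤ A * ‖p‖⁻¹ ^ B)
    (g k : ℕ) (h : 1 ≤ 2 * g + k) :
    ModerateGrowth (spreadConfigurations ε k) Prod.fst
      fun q => localCorr 0 H g (k + 1) q.2 := by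
  have hreg : RegularFamily (fun _ : Unit => (0 : ℂ)) (fun _ => H) := by
    refine .of_eventually_differentiableAt fun a => ?_
    filter_upwards [inter_mem_nhdsWithin {(0 : ℂ)}ᶜ (Metric.ball_mem_nhds 0 hε)] with p hp
    exact hd a p hp.1 (by simpa using hp.2)
  induction hN : 2 * g + k using Nat.strong_induction_on generalizing g k with
  | _ N ih =>
  subst hN
  by_cases h2 : 2 ≤ 2 * g + k
  · have hpos : ∀ q ∈ circleConfigurations ε k, 0 < q.1 := fun q hq => hq.1
    have hle : ∀ q ∈ circleConfigurations ε k, q.1 ≤ 1 := fun q hq => hq.2.1.trans hε1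
    have hH : ModerateGrowth (circleConfigurations ε k) Prod.fst fun q => H true q.2.2 := by
      refine ⟨A * 2 ^ B, B, by positivity, fun q hq => ?_⟩
      have h1 := hq.1
      have h3 : ‖q.2.2‖ = q.1 / 2 := hq.2.2.2
      refine (hHB q.2.2 (norm_pos_iff.1 (by linarith)) (by linarith [hq.2.1])).trans_eq ?_
      rw [h3, inv_div, div_eq_mul_inv, mul_pow, mul_assoc]
    have hker : ModerateGrowth (circleConfigurations ε k) Prod.fst fun q =>
        localKernel 0 H true (q.2.1 0) q.2.2 := by
      simp only [localKernel, localInvolution_zero, sub_eq_add_neg]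
      refine ((((ModerateGrowth.const _ _ _).mul hpos (.add hpos hle
        (moderateGrowth_cauchyKernel 0 (f := fun p => -p) fun p => norm_neg p) ?_)).mul
          hpos hH).mul hpos ?_)
      · have := (ModerateGrowth.const (circleConfigurations ε k) Prod.fst (-1)).mul hpos
          (moderateGrowth_cauchyKernel (ε := ε) (0 : Fin (k + 1)) (f := fun p => p) fun p => rfl)
        simpa only [neg_one_mul] using this
      · simpa using ModerateGrowth.const (circleConfigurations ε k) Prod.fst (-1)
    obtain ⟨C, N, hC, hbound⟩ := hker.mul hpos
      (moderateGrowth_bracket hε1 fun g' k' h1 h3 => ih _ h3 g' k' h1 rfl)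
    refine ⟨C, N, hC, ?_⟩
    rintro ⟨ρ, z⟩ ⟨hρ, hρε, hz, -⟩
    simp only at hρ hρε hz ⊢
    have hdom : ∀ p ∈ Metric.ball (0 : ℂ) ρ \ {0},
        ((), z, p) ∈ integrandDomain (fun _ : Unit => (0 : ℂ)) (fun _ => H) k true := by
      rintro p ⟨hp, hp0⟩
      have hp' : ‖p‖ < ρ := by simpa using hp
      have hdp := hd true p hp0 (hp'.trans_le hρε)
      refine ⟨hp0, fun i => ⟨norm_pos_iff.1 (hρ.trans_le (hz i).2), by simp [sgn_ne_zero]⟩,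
        by simp, by simp, by simp, fun i => ?_, fun i => ?_,
        ContinuousAt.comp (g := H true) (f := fun q : Unit × ℂ => q.2) hdp.continuousAt
          continuousAt_snd, hdp⟩
      · simp only [separation, (hz i).1, if_true, sub_ne_zero]
        rintro h0
        exact absurd (hz i).2 (by rw [h0]; exact not_le.2 hp')
      · simp only [separation, (hz i).1, if_true, sub_ne_zero, localInvolution_zero]
        rintro h0
        exact absurd (hz i).2 (by rw [h0, norm_neg]; exact not_le.2 hp')
    rw [localCorr_succ_of_label_true h2 (hz 0).1,
      residueAt_eq_circleIntegral (half_pos hρ) (half_lt_self hρ)]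
    · have hle2 := circleIntegral.norm_two_pi_i_inv_smul_integral_le_of_norm_le_const
        (f := localIntegrand 0 H g k true z) (c := 0) (R := ρ / 2) (C := C * ρ⁻¹ ^ N)
        (half_pos hρ).le fun p hp => hbound (ρ, z, p) ⟨hρ, hρε, hz, by simpa using hp⟩
      rw [smul_eq_mul] at hle2
      refine hle2.trans (mul_le_of_le_one_left (by positivity) ?_)
      linarith
    · exact differentiableOn_localIntegrand (l := fun _ : Unit => (0 : ℂ)) (H := fun _ => H)
        (fun g' k' h1 _ => hreg.isRegularCorr_separated g' k' h1) true ()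
        (Metric.isOpen_ball.sdiff isClosed_singleton) (γ := fun _ => z) (fun i => .const _ _)
        (p := fun p => p) differentiableOn_id hdom
  · obtain rfl : g = 0 := by omega
    obtain rfl : k = 1 := by omega
    refine ⟨1, 2, zero_le_one, ?_⟩
    rintro ⟨ρ, z⟩ ⟨h1, h3, h4, h5⟩
    simp only at h1 h3 h4 h5
    have h6 : (z 0).1 = (z 1).1 := by rw [(h4 0).1, (h4 1).1]
    refine (congrArg norm (localCorr_zero_two 0 H z)).trans_le ?_
    rw [cauchyKernel, separation, if_pos h6, if_pos h6, norm_pow, norm_div, norm_one, one_mul, one_div]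
    gcongr
    exact h5 0

theorem residueAt_eq_of_bounded_sub {f f' : ℂ → ℂ} {C : ℝ}
    (hf : ∀ᶠ p in 𝓝[≠] (0 : ℂ), DifferentiableAt ℂ f p)
    (hf' : ∀ᶠ p in 𝓝[≠] (0 : ℂ), DifferentiableAt ℂ f' p)
    (h : ∀ᶠ p in 𝓝[≠] (0 : ℂ), ‖f p - f' p‖ ≤ C) : residueAt f 0 = residueAt f' 0 := by
  have h0 : residueAt (fun p => f p - f' p) 0 = 0 :=
    (tendsto_residue_zero_of_bounded h).limUnder_eq
  obtain ⟨ε, hε, hsub⟩ := Metric.mem_nhdsWithin_iff.1 (hf.and hf')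
  have h1 : DifferentiableOn ℂ f (Metric.ball 0 ε \ {0}) :=
    fun p hp => (hsub ⟨hp.1, hp.2⟩).1.differentiableWithinAt
  have h2 : DifferentiableOn ℂ f' (Metric.ball 0 ε \ {0}) :=
    fun p hp => (hsub ⟨hp.1, hp.2⟩).2.differentiableWithinAt
  have hs : Metric.sphere (0 : ℂ) (ε / 2) ⊆ Metric.ball 0 ε \ {0} := by
    intro p hp
    rw [mem_sphere_zero_iff_norm] at hp
    refine ⟨by rw [mem_ball_zero_iff, hp]; linarith, ?_⟩
    rintro rfl
    rw [norm_zero] at hp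
    linarith
  rw [residueAt_eq_circleIntegral (half_pos hε) (half_lt_self hε)
      (show DifferentiableOn ℂ (fun p => f p - f' p) _ from h1.sub h2),
    circleIntegral.integral_sub
      ((h1.continuousOn.mono hs).circleIntegrable (half_pos hε).le)
      ((h2.continuousOn.mono hs).circleIntegrable (half_pos hε).le), mul_sub, sub_eq_zero] at h0
  rw [residueAt_eq_circleIntegral (half_pos hε) (half_lt_self hε) h1,
    residueAt_eq_circleIntegral (half_pos hε) (half_lt_self hε) h2, h0]

/-- The correlation functions depend only on a finite jet of the kernel at the branch point: if
`H' M` approximates `H` to order `M`, then the correlation functions coincide for large `M`. -/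
theorem eventually_localCorr_eq {H : Bool → ℂ → ℂ} {H' : ℕ → Bool → ℂ → ℂ} {ε : ℝ} (hε : 0 < ε)
    (hε1 : ε ≤ 1) (hd : ∀ a p, p ≠ 0 → ‖p‖ < ε → DifferentiableAt ℂ (H a) p)
    {A : ℝ} (hA : 0 ≤ A) {B : ℕ} (hHB : ∀ p, p ≠ 0 → ‖p‖ < ε → ‖H true p‖ ≤ A * ‖p‖⁻¹ ^ B)
    (hd' : ∀ M a, ∀ᶠ p in 𝓝[≠] (0 : ℂ), DifferentiableAt ℂ (H' M a) p)
    (hclose : ∀ M, ∃ C, ∀ᶠ p in 𝓝[≠] (0 : ℂ), ‖H' M true p - H true p‖ ≤ C * ‖p‖ ^ M)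
    (g k : ℕ) (h : 1 ≤ 2 * g + k) :
    ∀ᶠ M in atTop, ∀ z : Fin (k + 1) → Bool × ℂ, (∀ i, (z i).1 = true ∧ (z i).2 ≠ 0) →
      localCorr 0 (H' M) g (k + 1) z = localCorr 0 H g (k + 1) z := by
  have hreg : RegularFamily (fun _ : Unit => (0 : ℂ)) (fun _ => H) := by
    refine .of_eventually_differentiableAt fun a => ?_
    filter_upwards [inter_mem_nhdsWithin {(0 : ℂ)}ᶜ (Metric.ball_mem_nhds 0 hε)] with p hp
    exact hd a p hp.1 (by simpa using hp.2)
  induction hN : 2 * g + k using Nat.strong_induction_on generalizing g k with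
  | _ N ih =>
  subst hN
  by_cases h2 : 2 ≤ 2 * g + k
  · have hpos : ∀ q ∈ circleConfigurations ε k, 0 < q.1 := fun q hq => hq.1
    have hle : ∀ q ∈ circleConfigurations ε k, q.1 ≤ 1 := fun q hq => hq.2.1.trans hε1
    have hcauchy : ModerateGrowth (circleConfigurations ε k) Prod.fst fun q =>
        cauchyKernel 0 (q.2.1 0) (true, -q.2.2) + -1 * cauchyKernel 0 (q.2.1 0) (true, q.2.2) :=
      .add hpos hle (moderateGrowth_cauchyKernel 0 (f := fun p => -p) fun p => norm_neg p)
        ((ModerateGrowth.const _ _ (-1)).mul hpos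
          (moderateGrowth_cauchyKernel 0 (f := fun p => p) fun p => rfl))
    obtain ⟨C, N, hC, hbound⟩ := hcauchy.mul hpos
      (moderateGrowth_bracket (H := H) (g := g) hε1 fun g' k' h1 _ =>
        moderateGrowth_localCorr hε hε1 hd hA hHB g' k' h1)
    have hih : ∀ᶠ M in atTop, ∀ q ∈ Finset.range (2 * g + k) ×ˢ Finset.range (2 * g + k),
        1 ≤ 2 * q.1 + q.2 → 2 * q.1 + q.2 < 2 * g + k →
        ∀ z : Fin (q.2 + 1) → Bool × ℂ, (∀ i, (z i).1 = true ∧ (z i).2 ≠ 0) →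
          localCorr 0 (H' M) q.1 (q.2 + 1) z = localCorr 0 H q.1 (q.2 + 1) z := by
      refine (eventually_all_finset _).2 fun q _ => ?_
      by_cases hq : 1 ≤ 2 * q.1 + q.2 ∧ 2 * q.1 + q.2 < 2 * g + k
      · filter_upwards [ih _ hq.2 q.1 q.2 hq.1 rfl] with M hM _ _ using hM
      · exact Eventually.of_forall fun M h1 h3 => absurd ⟨h1, h3⟩ hq
    filter_upwards [hih, eventually_ge_atTop N] with M hM hMN z hz
    obtain ⟨C', hC'⟩ := hclose M
    rw [localCorr_succ_of_label_true h2 (hz 0).1, localCorr_succ_of_label_true h2 (hz 0).1]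
    have hreg' := RegularFamily.of_eventually_differentiableAt (hd' M)
    have hzreg : ∀ i, z i ∈ regularPoints 0 := fun i => ⟨(hz i).2, by simp [sgn_ne_zero]⟩
    refine residueAt_eq_of_bounded_sub (C := |C'| * C)
      (hreg'.eventually_differentiableAt_localIntegrand true () hzreg)
      (hreg.eventually_differentiableAt_localIntegrand true () hzreg) ?_
    have hsmall : ∀ r : ℝ, 0 < r → ∀ᶠ p in 𝓝[≠] (0 : ℂ), 2 * ‖p‖ ≤ r := by
      intro r hr
      refine mem_nhdsWithin_of_mem_nhds ?_
      filter_upwards [Metric.ball_mem_nhds (0 : ℂ) (half_pos hr)] with p hp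
      have : ‖p‖ < r / 2 := by simpa using hp
      linarith
    filter_upwards [hC', hsmall ε hε, hsmall 1 one_pos, self_mem_nhdsWithin,
      eventually_all.2 fun i => hsmall ‖(z i).2‖ (norm_pos_iff.2 (hz i).2)] with p h3 h4 h4' h5 h6
    have hp0 : 0 < ‖p‖ := norm_pos_iff.2 h5
    have hmem : (2 * ‖p‖, z, p) ∈ circleConfigurations ε k :=
      ⟨by positivity, h4, fun i => ⟨(hz i).1, h6 i⟩, by simp⟩
    have hb : bracket (localCorr 0 (H' M)) g k (true, p) (true, localInvolution 0 true p)
        (fun i => z i.succ) = bracket (localCorr 0 H) g k (true, p)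
          (true, localInvolution 0 true p) fun i => z i.succ := by
      have := bracket_eq_smul (V := localCorr 0 (H' M)) (W := localCorr 0 H) (c := 1) (u := 1)
        (pos := id) (D := {x | x.1 = true ∧ x.2 ≠ 0}) h2
        (fun g' k' hk1 hk2 z' hz' => ?_) (x := (true, p)) (y := (true, localInvolution 0 true p))
        (z := fun i => z i.succ) ⟨rfl, h5⟩
        ⟨rfl, by simpa [localInvolution_zero] using h5⟩ (fun i => hz i.succ)
      · simpa using this
      · rw [one_pow, one_pow, one_mul, one_mul]
        exact hM (g', k') (Finset.mem_product.2 ⟨Finset.mem_range.2 (by omega),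
          Finset.mem_range.2 (by omega)⟩) hk1 hk2 z' hz'
    have hdiff : localIntegrand 0 (H' M) g k true z p - localIntegrand 0 H g k true z p =
        -(1 / 2) * (H' M true p - H true p) *
          ((cauchyKernel 0 (z 0) (true, -p) + -1 * cauchyKernel 0 (z 0) (true, p)) *
          bracket (localCorr 0 H) g k (true, p) (true, localInvolution 0 true p)
            fun i => z i.succ) := by
      simp only [localIntegrand, hb]
      simp only [localKernel, localInvolution_zero]
      ring
    have h7 := hbound _ hmem
    simp only at h7
    rw [hdiff, norm_mul, norm_mul]
    have h8 : ‖p‖ ^ M * (2 * ‖p‖)⁻¹ ^ N ≤ 1 := by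
      have h9 : ‖p‖ ^ M ≤ ‖p‖ ^ N := pow_le_pow_of_le_one hp0.le (by linarith) hMN
      have h10 : (2 * ‖p‖)⁻¹ ^ N ≤ ‖p‖⁻¹ ^ N := by
        gcongr
        linarith
      calc ‖p‖ ^ M * (2 * ‖p‖)⁻¹ ^ N ≤ ‖p‖ ^ N * ‖p‖⁻¹ ^ N := by gcongr
        _ = 1 := by rw [← mul_pow, mul_inv_cancel₀ hp0.ne', one_pow]
    have h11 : ‖-(1 / 2 : ℂ)‖ ≤ 1 := by norm_num
    calc _ ≤ 1 * (|C'| * ‖p‖ ^ M) * (C * (2 * ‖p‖)⁻¹ ^ N) := by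
          gcongr
          exact h3.trans (by gcongr; exact le_abs_self C')
      _ = |C'| * C * (‖p‖ ^ M * (2 * ‖p‖)⁻¹ ^ N) := by ring
      _ ≤ |C'| * C * 1 := by gcongr
      _ = |C'| * C := mul_one _
  · obtain rfl : g = 0 := by omega
    obtain rfl : k = 1 := by omega
    refine Eventually.of_forall fun M z _ => ?_
    rw [show localCorr 0 (H' M) 0 (1 + 1) z = _ from localCorr_zero_two 0 (H' M) z,
      show localCorr 0 H 0 (1 + 1) z = _ from localCorr_zero_two 0 H z]

/-! ### Okuyama's curve -/

theorem evenProduct_neg (c : ℕ → ℂ) (w : ℂ) : evenProduct c (-w) = evenProduct c w := by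
  simp only [evenProduct, neg_sq]

theorem joukowskyCurve_weight {y : ℂ → ℂ} {l : ℂ} (hl : l ≠ 0) {c : ℕ → ℂ}
    (hy : ∀ z, z ≠ 0 → y z = (1 / 2) * (z - z⁻¹) * evenProduct c ((z - z⁻¹) / l)) (a : Bool) :
    ∀ᶠ t in 𝓝[≠] (0 : ℂ), productWeight l c a t =
      l ^ 3 / (l * ((joukowskyCurve y).omega01 (sgn a + l * t) -
        (joukowskyCurve y).omega01 (sgn a + l * t)⁻¹ * -((sgn a + l * t) ^ 2)⁻¹)) := by
  have h0 : ∀ᶠ t in 𝓝 (0 : ℂ), sgn a + l * t ≠ 0 :=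
    ContinuousAt.eventually_ne (by fun_prop) (by simp [sgn_ne_zero])
  filter_upwards [mem_nhdsWithin_of_mem_nhds h0] with t ht
  have hw : sinhCoordinate l a t = ((sgn a + l * t) - (sgn a + l * t)⁻¹) / l := by
    rw [sinhCoordinate, eq_div_iff hl, div_mul_eq_mul_div, div_eq_iff ht, sub_mul,
      inv_mul_cancel₀ ht]
    linear_combination -sgn_mul_self a
  rw [productWeight, hw]
  generalize sgn a + l * t = z at ht
  have homega : ∀ v : ℂ, v ≠ 0 → (joukowskyCurve y).omega01 v =
      (1 / 2) * (v - v⁻¹) * evenProduct c ((v - v⁻¹) / l) * (1 - (v ^ 2)⁻¹) := by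
    intro v hv
    rw [RationalSpectralCurve.omega01, show (joukowskyCurve y).y v = y v from rfl, hy v hv,
      show (joukowskyCurve y).x = fun z => z + z⁻¹ from rfl, (hasDerivAt_joukowsky hv).deriv]
  have hodd : (z⁻¹ - z⁻¹⁻¹) / l = -((z - z⁻¹) / l) := by
    rw [inv_inv]
    ring
  rw [homega z ht, homega z⁻¹ (inv_ne_zero ht), hodd, evenProduct_neg]
  generalize evenProduct c ((z - z⁻¹) / l) = P
  have hΔ : (1 / 2) * (z - z⁻¹) * P * (1 - (z ^ 2)⁻¹) -
      (1 / 2) * (z⁻¹ - z⁻¹⁻¹) * P * (1 - (z⁻¹ ^ 2)⁻¹) * -(z ^ 2)⁻¹ =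
        (((z - z⁻¹) / l) ^ 2 * P) * (l ^ 2 / z) := by
    field_simp
    ring
  rw [hΔ]
  generalize ((z - z⁻¹) / l) ^ 2 * P = X
  by_cases hX : X = 0
  · simp [hX]
  · field_simp

theorem okuyama_factor {Q z : ℂ} (hQ : 1 - Q ≠ 0) (hz : z ≠ 0) :
    (1 - Q * z ^ 2) * (1 - Q * (z ^ 2)⁻¹) / (1 - Q) ^ 2 =
      1 - (z - z⁻¹) ^ 2 * (Q / (1 - Q) ^ 2) := by
  field_simp
  ring

theorem one_sub_pow_ne_zero {q : ℝ} (hq0 : 0 < q) (hq1 : q < 1) (k : ℕ) :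
    (1 : ℂ) - (q : ℂ) ^ (k + 1) ≠ 0 := by
  have h : q ^ (k + 1) < 1 := pow_lt_one₀ hq0.le hq1 (by omega)
  have h2 : (1 - q ^ (k + 1) : ℝ) ≠ 0 := by linarith
  exact_mod_cast h2

/-- The coefficients of the truncated product as a sequence that depends on `M ∈ ℕ ∪ {∞}`. -/
def truncatedCoeff (q : ℝ) (M : ℕ∞) (k : ℕ) : ℂ :=
  if (k : ℕ∞) < M then (q : ℂ) ^ (k + 1) / (1 - (q : ℂ) ^ (k + 1)) ^ 2 else 0

theorem continuous_truncatedCoeff (q : ℝ) (k : ℕ) : Continuous fun M => truncatedCoeff q M k := by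
  have h : {M : ℕ∞ | (k : ℕ∞) < M} = Set.Ici ((k + 1 : ℕ) : ℕ∞) := by
    ext M
    simp only [Set.mem_ofPred_eq, Set.mem_Ici, Nat.cast_add, Nat.cast_one]
    exact (ENat.add_one_le_iff (ENat.natCast_ne_top k)).symm
  have hclopen : IsClopen {M : ℕ∞ | (k : ℕ∞) < M} := ⟨h ▸ isClosed_Ici, isOpen_Ioi⟩
  unfold truncatedCoeff
  refine continuous_const.if (fun M hM => ?_) continuous_const
  rw [hclopen.frontier_eq] at hM
  exact hM.elim

theorem norm_truncatedCoeff_le {q : ℝ} (hq0 : 0 < q) (hq1 : q < 1) (M : ℕ∞) (k : ℕ) :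
    ‖truncatedCoeff q M k‖ ≤ q ^ k * ((1 - q) ^ 2)⁻¹ := by
  have h0 : (0 : ℝ) < 1 - q := by linarith
  have h1 : q ^ (k + 1) ≤ q := pow_le_of_le_one hq0.le hq1.le (by omega)
  have h1' : q ^ (k + 1) ≤ q ^ k := pow_le_pow_of_le_one hq0.le hq1.le (by omega)
  unfold truncatedCoeff
  split_ifs
  · have h2 : ‖(q : ℂ) ^ (k + 1) / (1 - (q : ℂ) ^ (k + 1)) ^ 2‖ =
        q ^ (k + 1) * ((1 - q ^ (k + 1)) ^ 2)⁻¹ := by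
      rw [show (q : ℂ) ^ (k + 1) / (1 - (q : ℂ) ^ (k + 1)) ^ 2 =
        ((q ^ (k + 1) * ((1 - q ^ (k + 1)) ^ 2)⁻¹ : ℝ) : ℂ) by push_cast; rw [div_eq_mul_inv],
        Complex.norm_real, Real.norm_of_nonneg (by positivity)]
    rw [h2]
    gcongr
  · rw [norm_zero]
    positivity

theorem okuyamaYTrunc_eq {q : ℝ} (hq0 : 0 < q) (hq1 : q < 1) (M : ℕ) {z : ℂ} (hz : z ≠ 0) :
    okuyamaYTrunc q M z =
      (1 / 2) * (z - z⁻¹) * evenProduct (truncatedCoeff q M) ((z - z⁻¹) / (1 : ℝ)) := by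
  rw [okuyamaYTrunc, evenProduct, tprod_eq_prod (s := Finset.range M) fun k hk => ?_]
  · congr 1
    refine Finset.prod_congr rfl fun k hk => ?_
    rw [okuyama_factor (one_sub_pow_ne_zero hq0 hq1 k) hz, truncatedCoeff,
      if_pos (Nat.cast_lt.2 (Finset.mem_range.1 hk)), Complex.ofReal_one, div_one]
  · rw [truncatedCoeff, if_neg fun h => hk (Finset.mem_range.2 (Nat.cast_lt.1 h)), mul_zero,
      sub_zero]

theorem okuyamaY_eq {q : ℝ} (hq0 : 0 < q) (hq1 : q < 1) {z : ℂ} (hz : z ≠ 0) :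
    okuyamaY q z =
      (1 / 2) * (z - z⁻¹) * evenProduct (truncatedCoeff q ⊤) ((z - z⁻¹) / (1 : ℝ)) := by
  rw [okuyamaY, evenProduct]
  congr 1
  refine tprod_congr fun k => ?_
  rw [okuyama_factor (one_sub_pow_ne_zero hq0 hq1 k) hz, truncatedCoeff,
    if_pos (ENat.natCast_lt_top k), Complex.ofReal_one, div_one]

theorem regularFamily_truncated {q : ℝ} (hq0 : 0 < q) (hq1 : q < 1) :
    RegularFamily (fun _ : ℕ∞ => ((1 : ℝ) : ℂ))
      fun M => productWeight ((1 : ℝ) : ℂ) (truncatedCoeff q M) :=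
  regularFamily_productWeight continuous_const (continuous_truncatedCoeff q)
    ((summable_geometric_of_lt_one hq0.le hq1).mul_right _) (norm_truncatedCoeff_le hq0 hq1)

/-- In the coordinate `t = z - 1`, the correlation functions of the curves of Okuyama's type are
those of the recursion in local coordinates with `l = 1`. -/
theorem joukowskyCurve_corr_eq_localCorr {q : ℝ} (hq0 : 0 < q) (hq1 : q < 1) (M : ℕ∞) {y : ℂ → ℂ}
    (hy : ∀ z, z ≠ 0 → y z =
      (1 / 2) * (z - z⁻¹) * evenProduct (truncatedCoeff q M) ((z - z⁻¹) / (1 : ℝ)))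
    {g k : ℕ} (h : 1 ≤ 2 * g + k) {z : Fin (k + 1) → ℂ} (hz : ∀ i, z i ≠ 1 ∧ z i ≠ -1) :
    (joukowskyCurve y).corr g (k + 1) z = localCorr ((1 : ℝ) : ℂ)
      (productWeight ((1 : ℝ) : ℂ) (truncatedCoeff q M)) g (k + 1) fun i => (true, z i - 1) := by
  have hl : ((1 : ℝ) : ℂ) ≠ 0 := by simp
  rw [joukowskyCurve_corr one_pos (pow_ne_zero 3 hl) (joukowskyCurve_weight hl hy)
    (fun g m a z hz =>
      (regularFamily_truncated hq0 hq1).eventually_differentiableAt_localIntegrand a M hz) h]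
  · simp only [Complex.ofReal_one, one_pow, one_mul]
    congr 1
    funext i
    simp [position]
  · intro i
    refine ⟨sub_ne_zero.2 (hz i).1, ?_⟩
    simp only [sgn_true, Complex.ofReal_one, one_mul, mul_one]
    intro h0
    exact (hz i).2 (by linear_combination h0)

theorem tendsto_okuyamaCurveTrunc_corr {q : ℝ} (hq0 : 0 < q) (hq1 : q < 1) {g k : ℕ}
    (h : 2 ≤ 2 * g + k) {z : Fin (k + 1) → ℂ} (hz : ∀ i, z i ≠ 1 ∧ z i ≠ -1) :
    Tendsto (fun M : ℕ => (okuyamaCurveTrunc q M).corr g (k + 1) z) atTop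
      (𝓝 ((okuyamaCurve q).corr g (k + 1) z)) := by
  have hmem : ∀ i, ((true, z i - 1) : Bool × ℂ) ∈ regularPoints ((1 : ℝ) : ℂ) := by
    intro i
    refine ⟨sub_ne_zero.2 (hz i).1, ?_⟩
    simp only [sgn_true, Complex.ofReal_one, one_mul, mul_one]
    intro h0
    exact (hz i).2 (by linear_combination h0)
  have hcont : Continuous fun M : ℕ∞ => localCorr ((1 : ℝ) : ℂ)
      (productWeight ((1 : ℝ) : ℂ) (truncatedCoeff q M)) g (k + 1) fun i => (true, z i - 1) :=
    ((regularFamily_truncated hq0 hq1).isRegularCorr h).continuousOn.comp_continuous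
      (f := fun M : ℕ∞ => (M, fun i => ((true, z i - 1) : Bool × ℂ))) (by fun_prop)
      fun _ => hmem
  have hlim := (hcont.tendsto ⊤).comp ENat.tendsto_natCast_nhds_top
  have h1 : 1 ≤ 2 * g + k := by omega
  rw [← joukowskyCurve_corr_eq_localCorr hq0 hq1 ⊤ (fun v hv => okuyamaY_eq hq0 hq1 hv) h1 hz]
    at hlim
  exact hlim.congr fun M => (joukowskyCurve_corr_eq_localCorr hq0 hq1 M
    (fun v hv => okuyamaYTrunc_eq hq0 hq1 M hv) h1 hz).symm

/-! ### The Weil–Petersson curve -/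

/-- The weight of the decoupled recursion that belongs to `halfSquareCurve y`. -/
def halfSquareWeight (y : ℂ → ℂ) (_ : Bool) (t : ℂ) : ℂ :=
  1 / ((halfSquareCurve y).omega01 t + (halfSquareCurve y).omega01 (-t))

theorem halfSquareCurve_omega01 (y : ℂ → ℂ) (t : ℂ) :
    (halfSquareCurve y).omega01 t = y t * t := by
  rw [RationalSpectralCurve.omega01, show (halfSquareCurve y).x = fun t => t ^ 2 / 2 from rfl]
  simp [show (halfSquareCurve y).y = y from rfl]

theorem halfSquareWeight_eq {y h : ℂ → ℂ} (hy : ∀ t, y t = t * h t) (a : Bool) (t : ℂ) :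
    halfSquareWeight y a t = 1 / (t ^ 2 * (h t + h (-t))) := by
  rw [halfSquareWeight, halfSquareCurve_omega01, halfSquareCurve_omega01, hy, hy]
  congr 1
  ring

theorem exists_forall_one_le_norm_even_part {h : ℂ → ℂ} (hh : Differentiable ℂ h) (h0 : h 0 = 1) :
    ∃ ε, 0 < ε ∧ ε ≤ 1 ∧ ∀ t, ‖t‖ < ε → 1 ≤ ‖h t + h (-t)‖ := by
  have hc : Continuous fun t => ‖h t + h (-t)‖ :=
    (hh.continuous.add (hh.continuous.comp continuous_neg)).norm
  have h1 : ∀ᶠ t in 𝓝 (0 : ℂ), 1 < ‖h t + h (-t)‖ := by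
    refine (hc.tendsto 0).eventually (lt_mem_nhds ?_)
    rw [neg_zero, h0]
    norm_num
  obtain ⟨ε, hε, hball⟩ := Metric.eventually_nhds_iff_ball.1 h1
  exact ⟨min ε 1, lt_min hε one_pos, min_le_right _ _, fun t ht =>
    (hball t (mem_ball_zero_iff.2 (ht.trans_le (min_le_left _ _)))).le⟩

theorem differentiableAt_halfSquareWeight {y h : ℂ → ℂ} (hh : Differentiable ℂ h)
    (hy : ∀ t, y t = t * h t) (a : Bool) {t : ℂ} (ht : t ≠ 0) (hne : h t + h (-t) ≠ 0) :
    DifferentiableAt ℂ (halfSquareWeight y a) t := by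
  rw [show halfSquareWeight y a = fun t => 1 / (t ^ 2 * (h t + h (-t))) from
    funext (halfSquareWeight_eq hy a)]
  exact DifferentiableAt.div (by fun_prop)
    ((differentiableAt_id.pow 2).mul ((hh t).add ((hh (-t)).comp t differentiableAt_id.neg)))
    (mul_ne_zero (pow_ne_zero 2 ht) hne)

theorem eventually_differentiableAt_halfSquareWeight {y h : ℂ → ℂ} (hh : Differentiable ℂ h)
    (h0 : h 0 = 1) (hy : ∀ t, y t = t * h t) (a : Bool) :
    ∀ᶠ t in 𝓝[≠] (0 : ℂ), DifferentiableAt ℂ (halfSquareWeight y a) t := by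
  obtain ⟨ε, hε, -, hle⟩ := exists_forall_one_le_norm_even_part hh h0
  filter_upwards [inter_mem_nhdsWithin {(0 : ℂ)}ᶜ (Metric.ball_mem_nhds 0 hε)] with t ht
  exact differentiableAt_halfSquareWeight hh hy a ht.1
    (norm_pos_iff.1 (one_pos.trans_le (hle t (mem_ball_zero_iff.1 ht.2))))

theorem halfSquareCurve_corr_eq_localCorr {y h : ℂ → ℂ} (hh : Differentiable ℂ h)
    (h0 : h 0 = 1) (hy : ∀ t, y t = t * h t) {g k : ℕ} (hgk : 1 ≤ 2 * g + k) {t : Fin (k + 1) → ℂ}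
    (ht : ∀ i, t i ≠ 0) :
    (halfSquareCurve y).corr g (k + 1) t =
      localCorr 0 (halfSquareWeight y) g (k + 1) fun i => (true, t i) := by
  rw [halfSquareCurve_corr one_ne_zero (Eventually.of_forall fun t => rfl)
    (fun g m a z hz => (RegularFamily.of_eventually_differentiableAt
      (eventually_differentiableAt_halfSquareWeight hh h0 hy)).eventually_differentiableAt_localIntegrand
        a () hz) hgk ht, one_pow, one_mul]

/-- Curves whose functions `y` agree to high order at the branch point have the same correlation
functions. -/
theorem eventually_halfSquareCurve_corr_eq {y h : ℂ → ℂ} {y' h' : ℕ → ℂ → ℂ}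
    (hh : Differentiable ℂ h) (h0 : h 0 = 1) (hy : ∀ t, y t = t * h t)
    (hh' : ∀ M, Differentiable ℂ (h' M)) (h0' : ∀ M, h' M 0 = 1)
    (hy' : ∀ M t, y' M t = t * h' M t)
    (hclose : ∀ M, ∃ C, ∀ t, ‖t‖ ≤ 1 → ‖h' M t - h t‖ ≤ C * ‖t‖ ^ (M + 2))
    {g k : ℕ} (hgk : 1 ≤ 2 * g + k) :
    ∀ᶠ M in atTop, ∀ t : Fin (k + 1) → ℂ, (∀ i, t i ≠ 0) →
      (halfSquareCurve (y' M)).corr g (k + 1) t = (halfSquareCurve y).corr g (k + 1) t := by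
  obtain ⟨ε, hε, hε1, hle⟩ := exists_forall_one_le_norm_even_part hh h0
  have hne : ∀ t, ‖t‖ < ε → h t + h (-t) ≠ 0 := fun t ht =>
    norm_pos_iff.1 (one_pos.trans_le (hle t ht))
  have key := eventually_localCorr_eq (H := halfSquareWeight y)
    (H' := fun M => halfSquareWeight (y' M)) hε hε1
    (fun a p hp hpε => differentiableAt_halfSquareWeight hh hy a hp (hne p hpε))
    (A := 1) zero_le_one (B := 2) (fun p hp hpε => ?_)
    (fun M => eventually_differentiableAt_halfSquareWeight (hh' M) (h0' M) (hy' M))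
    (fun M => ?_) g k hgk
  · filter_upwards [key] with M hM t ht
    rw [halfSquareCurve_corr_eq_localCorr hh h0 hy hgk ht,
      halfSquareCurve_corr_eq_localCorr (hh' M) (h0' M) (hy' M) hgk ht]
    exact hM _ fun i => ⟨rfl, ht i⟩
  · rw [halfSquareWeight_eq hy, norm_div, norm_one, norm_mul, norm_pow, one_mul, inv_pow, one_div]
    have hp' : 0 < ‖p‖ := norm_pos_iff.2 hp
    exact inv_anti₀ (by positivity) (le_mul_of_one_le_right (by positivity) (hle p hpε))
  · obtain ⟨C, hC⟩ := hclose M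
    obtain ⟨ε', hε', hε1', hle'⟩ := exists_forall_one_le_norm_even_part (hh' M) (h0' M)
    refine ⟨2 * C, ?_⟩
    filter_upwards [inter_mem_nhdsWithin {(0 : ℂ)}ᶜ (Metric.ball_mem_nhds 0 hε),
      inter_mem_nhdsWithin {(0 : ℂ)}ᶜ (Metric.ball_mem_nhds 0 hε')] with p hp hp'
    have hp0 : p ≠ 0 := hp.1
    have hpε : ‖p‖ < ε := mem_ball_zero_iff.1 hp.2
    have hpε' : ‖p‖ < ε' := mem_ball_zero_iff.1 hp'.2
    have hne' : h' M p + h' M (-p) ≠ 0 := norm_pos_iff.1 (one_pos.trans_le (hle' p hpε'))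
    have hpos : 0 < ‖p‖ := norm_pos_iff.2 hp0
    rw [halfSquareWeight_eq hy, halfSquareWeight_eq (hy' M),
      show 1 / (p ^ 2 * (h' M p + h' M (-p))) - 1 / (p ^ 2 * (h p + h (-p))) =
        -((h' M p - h p) + (h' M (-p) - h (-p))) /
          (p ^ 2 * ((h' M p + h' M (-p)) * (h p + h (-p)))) by
        have := hne p hpε
        field_simp
        ring, norm_div, norm_neg, norm_mul, norm_mul, norm_pow, div_le_iff₀ (by
          have := hle p hpε
          have := hle' p hpε'
          positivity)]
    have h1 := hC p (hpε.le.trans hε1)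
    have h2 := hC (-p) (by rw [norm_neg]; exact hpε.le.trans hε1)
    rw [norm_neg] at h2
    calc ‖(h' M p - h p) + (h' M (-p) - h (-p))‖
        ≤ C * ‖p‖ ^ (M + 2) + C * ‖p‖ ^ (M + 2) := (norm_add_le _ _).trans (add_le_add h1 h2)
      _ = 2 * C * ‖p‖ ^ M * (‖p‖ ^ 2 * (1 * 1)) := by ring
      _ ≤ 2 * C * ‖p‖ ^ M * (‖p‖ ^ 2 * (‖h' M p + h' M (-p)‖ * ‖h p + h (-p)‖)) := by
        have hC0 : 0 ≤ C := by
          refine nonneg_of_mul_nonneg_left ((norm_nonneg _).trans h1) (by positivity)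
        have := hle p hpε
        have := hle' p hpε'
        gcongr

/-- The Taylor coefficients of `sin(2πt) / (2πt)` in the variable `t²`. -/
def wpCoeff (k : ℕ) : ℂ := (-1) ^ k * (2 * (π : ℂ)) ^ (2 * k) / ((2 * k + 1).factorial : ℂ)

/-- The entire function `sin(2πt) / (2πt)`. -/
def wpQuotient : ℂ → ℂ := dslope (fun t : ℂ => Complex.sin (2 * (π : ℂ) * t) / (2 * (π : ℂ))) 0

theorem two_pi_ne_zero_complex : 2 * (π : ℂ) ≠ 0 :=
  mul_ne_zero two_ne_zero (Complex.ofReal_ne_zero.2 Real.pi_ne_zero)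

theorem mul_wpQuotient (t : ℂ) :
    Complex.sin (2 * (π : ℂ) * t) / (2 * (π : ℂ)) = t * wpQuotient t := by
  have := sub_smul_dslope (fun t : ℂ => Complex.sin (2 * (π : ℂ) * t) / (2 * (π : ℂ))) 0 t
  simpa [wpQuotient] using this.symm

theorem differentiable_wpQuotient : Differentiable ℂ wpQuotient := by
  rw [← differentiableOn_univ]
  refine (Complex.differentiableOn_dslope univ_mem).2 ?_
  fun_prop

theorem wpQuotient_zero : wpQuotient 0 = 1 := by
  rw [wpQuotient, dslope_same]
  have h : HasDerivAt (fun t : ℂ => Complex.sin (2 * (π : ℂ) * t) / (2 * (π : ℂ)))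
      (Complex.cos (2 * (π : ℂ) * 0) * (2 * (π : ℂ) * 1) / (2 * (π : ℂ))) 0 :=
    ((Complex.hasDerivAt_sin _).comp (0 : ℂ)
      ((hasDerivAt_id (0 : ℂ)).const_mul (2 * (π : ℂ)))).div_const _
  rw [h.deriv, mul_zero, Complex.cos_zero, one_mul, mul_one, div_self two_pi_ne_zero_complex]

theorem hasSum_wpCoeff (t : ℂ) :
    HasSum (fun k => wpCoeff k * t ^ (2 * k + 1)) (t * wpQuotient t) := by
  rw [← mul_wpQuotient]
  refine ((Complex.hasSum_sin (2 * (π : ℂ) * t)).div_const (2 * (π : ℂ))).congr_fun ?_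
  intro k
  have hc := two_pi_ne_zero_complex
  simp only [wpCoeff]
  generalize 2 * (π : ℂ) = c at hc ⊢
  rw [mul_pow, pow_succ c]
  field_simp

theorem norm_sum_wpCoeff_sub_le (M : ℕ) : ∃ C, ∀ t : ℂ, ‖t‖ ≤ 1 →
    ‖(∑ k ∈ Finset.range (M + 1), wpCoeff k * t ^ (2 * k)) - wpQuotient t‖ ≤
      C * ‖t‖ ^ (M + 2) := by
  have hsum1 : Summable fun k => ‖wpCoeff k‖ := by
    simpa using (hasSum_wpCoeff 1).summable.norm
  have hsum : Summable fun k => ‖wpCoeff (k + (M + 1))‖ :=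
    (summable_nat_add_iff (f := fun k => ‖wpCoeff k‖) (M + 1)).2 hsum1
  refine ⟨∑' k, ‖wpCoeff (k + (M + 1))‖, fun t ht => ?_⟩
  by_cases h0 : t = 0
  · subst h0
    rw [wpQuotient_zero, Finset.sum_eq_single_of_mem 0 (by simp) fun k _ hk => by simp [hk]]
    simp [wpCoeff]
  have htail :=
    (hasSum_nat_add_iff' (f := fun k => wpCoeff k * t ^ (2 * k + 1)) (M + 1)).2 (hasSum_wpCoeff t)
  have hb : ∀ k, ‖wpCoeff (k + (M + 1)) * t ^ (2 * (k + (M + 1)) + 1)‖ ≤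
      ‖t‖ ^ (M + 3) * ‖wpCoeff (k + (M + 1))‖ := by
    intro k
    rw [norm_mul, norm_pow, mul_comm]
    exact mul_le_mul_of_nonneg_right (pow_le_pow_of_le_one (norm_nonneg t) ht (by omega))
      (norm_nonneg _)
  have h1 := tsum_of_norm_bounded (hsum.mul_left (‖t‖ ^ (M + 3))).hasSum hb
  rw [htail.tsum_eq, tsum_mul_left] at h1
  have h2 : t * wpQuotient t - ∑ k ∈ Finset.range (M + 1), wpCoeff k * t ^ (2 * k + 1) =
      -(t * ((∑ k ∈ Finset.range (M + 1), wpCoeff k * t ^ (2 * k)) - wpQuotient t)) := by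
    rw [mul_sub, Finset.mul_sum, neg_sub]
    congr 1
    exact Finset.sum_congr rfl fun k _ => by ring
  rw [h2, norm_neg, norm_mul] at h1
  generalize ∑' k, ‖wpCoeff (k + (M + 1))‖ = C at h1 ⊢
  have h3 : ‖t‖ ^ (M + 3) * C = ‖t‖ * (C * ‖t‖ ^ (M + 2)) := by ring
  rw [h3] at h1
  exact le_of_mul_le_mul_left h1 (norm_pos_iff.2 h0)

theorem eventually_wpCurveTrunc_corr_eq {g k : ℕ} (h : 1 ≤ 2 * g + k) :
    ∀ᶠ M : ℕ in atTop, ∀ t : Fin (k + 1) → ℂ, (∀ i, t i ≠ 0) →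
      (wpCurveTrunc M).corr g (k + 1) t = wpCurve.corr g (k + 1) t := by
  refine eventually_halfSquareCurve_corr_eq differentiable_wpQuotient wpQuotient_zero mul_wpQuotient
    (h' := fun M t => ∑ k ∈ Finset.range (M + 1), wpCoeff k * t ^ (2 * k))
    (fun M => by fun_prop) (fun M => ?_) (fun M t => ?_) norm_sum_wpCoeff_sub_le h
  · rw [Finset.sum_eq_single_of_mem 0 (by simp) fun k _ hk => by simp [hk]]
    simp [wpCoeff]
  · rw [Finset.mul_sum]
    exact Finset.sum_congr rfl fun k _ => by rw [wpCoeff]; ring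

/-! ### The limit of Okuyama's curve -/

/-- The coefficients `(λ / (2 sinh (λ (k + 1) / 2)))²` of Okuyama's product for `q = exp (-λ)` in the
variable `(z - z⁻¹) / λ`. They are written in terms of the quotient `sinh x / x`, continued to `x = 0`, so
that they are continuous at `λ = 0`. -/
def okuyamaCoeff (l : ℝ) (k : ℕ) : ℂ :=
  (((((k : ℝ) + 1) * dslope Real.sinh 0 (l * (k + 1) / 2)) ^ 2)⁻¹ : ℝ)

theorem continuous_dslope_sinh : Continuous (dslope Real.sinh 0) := by
  rw [← continuousOn_univ]
  exact (continuousOn_dslope univ_mem).2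
    ⟨Real.continuous_sinh.continuousOn, Real.differentiable_sinh.differentiableAt⟩

theorem dslope_sinh_zero : dslope Real.sinh 0 0 = 1 := by
  rw [dslope_same, Real.deriv_sinh, Real.cosh_zero]

theorem dslope_sinh_of_ne {x : ℝ} (hx : x ≠ 0) : dslope Real.sinh 0 x = Real.sinh x / x := by
  rw [dslope_of_ne _ hx, slope_def_field, Real.sinh_zero, sub_zero, sub_zero]

theorem one_le_dslope_sinh (x : ℝ) : 1 ≤ dslope Real.sinh 0 x := by
  rcases lt_trichotomy x 0 with hx | rfl | hx
  · rw [dslope_sinh_of_ne hx.ne, one_le_div_of_neg hx]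
    exact Real.sinh_le_self_iff.2 hx.le
  · rw [dslope_sinh_zero]
  · rw [dslope_sinh_of_ne hx.ne', one_le_div hx]
    exact Real.self_le_sinh_iff.2 hx.le

theorem continuous_okuyamaCoeff (k : ℕ) : Continuous fun l => okuyamaCoeff l k := by
  unfold okuyamaCoeff
  refine Complex.continuous_ofReal.comp (Continuous.inv₀ ?_ fun l => ?_)
  · exact ((continuous_const.mul (continuous_dslope_sinh.comp (by fun_prop))).pow 2)
  · have := one_le_dslope_sinh (l * (k + 1) / 2)
    positivity

theorem norm_okuyamaCoeff_le (l : ℝ) (k : ℕ) : ‖okuyamaCoeff l k‖ ≤ (((k : ℝ) + 1) ^ 2)⁻¹ := by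
  have h := one_le_dslope_sinh (l * (k + 1) / 2)
  rw [okuyamaCoeff, Complex.norm_real, Real.norm_of_nonneg (by positivity)]
  refine inv_anti₀ (by positivity) ?_
  gcongr
  exact le_mul_of_one_le_right (by positivity) h

theorem summable_inv_succ_sq : Summable fun k : ℕ => (((k : ℝ) + 1) ^ 2)⁻¹ := by
  have := (summable_nat_add_iff (f := fun k : ℕ => ((k : ℝ) ^ 2)⁻¹) 1).2
    (Real.summable_nat_pow_inv.2 one_lt_two)
  simpa using this

theorem regularFamily_okuyama :
    RegularFamily (fun l : ℝ => (l : ℂ)) fun l => productWeight l (okuyamaCoeff l) :=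
  regularFamily_productWeight Complex.continuous_ofReal continuous_okuyamaCoeff
    summable_inv_succ_sq norm_okuyamaCoeff_le

theorem okuyamaCoeff_eq {l : ℝ} (hl : 0 < l) (k : ℕ) :
    okuyamaCoeff l k = (l : ℂ) ^ 2 * (((Real.exp (-l) : ℝ) : ℂ) ^ (k + 1) /
      (1 - ((Real.exp (-l) : ℝ) : ℂ) ^ (k + 1)) ^ 2) := by
  have hk : (0 : ℝ) < k + 1 := by positivity
  have hx : l * (k + 1) / 2 ≠ 0 := by positivity
  have hE : 1 < Real.exp (l * (k + 1) / 2) := Real.one_lt_exp_iff.2 (by positivity)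
  have hQ : Real.exp (-l) ^ (k + 1) = (Real.exp (l * (k + 1) / 2) ^ 2)⁻¹ := by
    rw [← Real.exp_nat_mul, ← Real.exp_nat_mul, ← Real.exp_neg]
    congr 1
    push_cast
    ring
  have hreal : ((((k : ℝ) + 1) * dslope Real.sinh 0 (l * (k + 1) / 2)) ^ 2)⁻¹ =
      l ^ 2 * (Real.exp (-l) ^ (k + 1) / (1 - Real.exp (-l) ^ (k + 1)) ^ 2) := by
    rw [dslope_sinh_of_ne hx, Real.sinh_eq, Real.exp_neg (l * (k + 1) / 2), hQ]
    generalize Real.exp (l * (k + 1) / 2) = E at hE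
    have h1 : E ^ 2 - 1 ≠ 0 := by nlinarith
    have h2 : E ≠ 0 := by linarith
    have h3 : E - E⁻¹ = (E ^ 2 - 1) / E := by field_simp
    have h4 : 1 - (E ^ 2)⁻¹ = (E ^ 2 - 1) / E ^ 2 := by field_simp
    rw [h3, h4]
    field_simp
  rw [okuyamaCoeff, hreal]
  push_cast
  ring

theorem okuyamaY_exp_eq {l : ℝ} (hl : 0 < l) {z : ℂ} (hz : z ≠ 0) :
    okuyamaY (Real.exp (-l)) z =
      (1 / 2) * (z - z⁻¹) * evenProduct (okuyamaCoeff l) ((z - z⁻¹) / l) := by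
  have hl' : (l : ℂ) ≠ 0 := Complex.ofReal_ne_zero.2 hl.ne'
  rw [okuyamaY, evenProduct]
  congr 1
  refine tprod_congr fun k => ?_
  rw [okuyama_factor (one_sub_pow_ne_zero (Real.exp_pos _)
    (by simpa using hl) k) hz, okuyamaCoeff_eq hl]
  generalize ((Real.exp (-l) : ℝ) : ℂ) ^ (k + 1) /
    (1 - ((Real.exp (-l) : ℝ) : ℂ) ^ (k + 1)) ^ 2 = c
  rw [div_pow, ← mul_assoc, div_mul_cancel₀ _ (pow_ne_zero 2 hl')]

/-- Okuyama's correlation functions near the branch point `1`, in the coordinate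
`t = (z - 1) / l`. -/
theorem okuyamaCurve_corr_eq_localCorr {l : ℝ} (hl : 0 < l) {g k : ℕ} (h : 1 ≤ 2 * g + k)
    {t : Fin (k + 1) → ℂ} (ht : ∀ i, t i ≠ 0 ∧ 2 + (l : ℂ) * t i ≠ 0) :
    localCorr l (productWeight l (okuyamaCoeff l)) g (k + 1) (fun i => (true, t i)) =
      ((l : ℂ) ^ 3) ^ (2 * g + k - 1) * (l : ℂ) ^ (k + 1) *
        (okuyamaCurve (Real.exp (-l))).corr g (k + 1) fun i => (l : ℂ) * t i + 1 := by
  have hl' : (l : ℂ) ≠ 0 := Complex.ofReal_ne_zero.2 hl.ne'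
  rw [okuyamaCurve, joukowskyCurve_corr hl (pow_ne_zero 3 hl')
    (joukowskyCurve_weight hl' fun z hz => okuyamaY_exp_eq hl hz)
    (fun g m a z hz => regularFamily_okuyama.eventually_differentiableAt_localIntegrand a l hz) h]
  · congr 2
    funext i
    simp [position, add_comm]
  · intro i
    exact ⟨(ht i).1, by simpa using (ht i).2⟩

theorem evenProduct_okuyamaCoeff_zero {t : ℂ} (ht : t ≠ 0) :
    evenProduct (okuyamaCoeff 0) (2 * t) =
      Complex.sin (2 * (π : ℂ) * t) / (2 * (π : ℂ) * t) := by
  have h1 : ∀ k, 1 - (2 * t) ^ 2 * okuyamaCoeff 0 k = 1 + sineTerm (2 * t) k := by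
    intro k
    rw [okuyamaCoeff, zero_mul, zero_div, dslope_sinh_zero, mul_one, sineTerm]
    push_cast
    ring
  rw [evenProduct, tprod_congr h1]
  have h2 := (multipliable_sineTerm (2 * t)).hasProd.tendsto_prod_nat
  rw [tendsto_nhds_unique h2 (tendsto_euler_sin_prod' (mul_ne_zero two_ne_zero ht))]
  ring_nf

/-- At `l = 0` the recursion at the branch point `1` is that of the Weil–Petersson curve, with the
kernel multiplied by `1 / 2`. -/
theorem localCorr_zero_eq_wpCurve_corr {g k : ℕ} (h : 1 ≤ 2 * g + k) {t : Fin (k + 1) → ℂ}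
    (ht : ∀ i, t i ≠ 0) :
    localCorr 0 (productWeight 0 (okuyamaCoeff 0)) g (k + 1) (fun i => (true, t i)) =
      (1 / 2) ^ (2 * g + k - 1) * wpCurve.corr g (k + 1) t := by
  refine halfSquareCurve_corr (by norm_num) ?_ (fun g m a z hz => ?_) h ht
  · filter_upwards [self_mem_nhdsWithin] with t ht0
    have ht0' : t ≠ 0 := ht0
    have hs : sinhCoordinate 0 true t = 2 * t := by
      simp [sinhCoordinate, mul_comm]
    rw [productWeight, hs, evenProduct_okuyamaCoeff_zero ht0', halfSquareCurve_omega01,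
      halfSquareCurve_omega01, mul_neg, mul_neg, Complex.sin_neg, sgn_true, zero_mul, add_zero]
    have hπ : (π : ℂ) ≠ 0 := Complex.ofReal_ne_zero.2 Real.pi_ne_zero
    by_cases hsin : Complex.sin (2 * (π : ℂ) * t) = 0
    · simp [hsin]
    · field_simp
      ring
  · have := regularFamily_okuyama.eventually_differentiableAt_localIntegrand (g := g) a (0 : ℝ)
      (z := z) (by simpa only [Complex.ofReal_zero] using hz)
    simpa only [Complex.ofReal_zero] using this

theorem tendstoLocallyUniformlyOn_okuyamaCurve_corr {g k : ℕ} (h : 2 ≤ 2 * g + k) :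
    TendstoLocallyUniformlyOn
      (fun (l : ℝ) (t : Fin (k + 1) → ℂ) => ((l : ℂ) ^ 3) ^ (2 * g + k - 1) * (l : ℂ) ^ (k + 1) *
        (okuyamaCurve (Real.exp (-l))).corr g (k + 1) fun i => (l : ℂ) * t i + 1)
      (fun t => (1 / 2) ^ (2 * g + k - 1) * wpCurve.corr g (k + 1) t)
      (𝓝[>] (0 : ℝ)) {t | ∀ i, t i ≠ 0} := by
  rw [tendstoLocallyUniformlyOn_iff_forall_tendsto]
  intro t₀ ht₀
  have h1 : 1 ≤ 2 * g + k := by omega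
  let G : ℝ × (Fin (k + 1) → ℂ) → ℂ := fun q =>
    localCorr q.1 (productWeight q.1 (okuyamaCoeff q.1)) g (k + 1) fun i => (true, q.2 i)
  have hgood : ∀ᶠ q : ℝ × (Fin (k + 1) → ℂ) in 𝓝 (0, t₀), ∀ i, q.2 i ≠ 0 ∧
      2 + (q.1 : ℂ) * q.2 i ≠ 0 := by
    refine eventually_all.2 fun i => Eventually.and ?_ ?_
    · exact ContinuousAt.eventually_ne (y := 0) (by fun_prop) (ht₀ i)
    · exact ContinuousAt.eventually_ne (y := 0) (by fun_prop) (by simp)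
  have hG : ContinuousAt G (0, t₀) := by
    obtain ⟨N, hN, hNo, hmem⟩ := eventually_nhds_iff.1 hgood
    refine ContinuousOn.continuousAt (s := N) ?_ (hNo.mem_nhds hmem)
    refine (regularFamily_okuyama.isRegularCorr h).continuousOn.comp
      (f := fun q : ℝ × (Fin (k + 1) → ℂ) => (q.1, fun i => ((true, q.2 i) : Bool × ℂ)))
      (by fun_prop) fun q hq i => ?_
    exact ⟨(hN q hq i).1, by simpa using (hN q hq i).2⟩
  have hG0 : ∀ t : Fin (k + 1) → ℂ, (∀ i, t i ≠ 0) →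
      G (0, t) = (1 / 2) ^ (2 * g + k - 1) * wpCurve.corr g (k + 1) t := by
    intro t ht
    simp only [G, Complex.ofReal_zero]
    exact localCorr_zero_eq_wpCurve_corr h1 ht
  have hle : 𝓝[>] (0 : ℝ) ×ˢ 𝓝[{t : Fin (k + 1) → ℂ | ∀ i, t i ≠ 0}] t₀ ≤ 𝓝 (0, t₀) := by
    rw [nhds_prod_eq]
    exact prod_mono nhdsWithin_le_nhds nhdsWithin_le_nhds
  have hpair : Tendsto (fun q : ℝ × (Fin (k + 1) → ℂ) => (G (0, q.2), G q))
      (𝓝[>] (0 : ℝ) ×ˢ 𝓝[{t : Fin (k + 1) → ℂ | ∀ i, t i ≠ 0}] t₀) (uniformity ℂ) := by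
    have h0 : ContinuousAt (fun q : ℝ × (Fin (k + 1) → ℂ) => G (0, q.2)) (0, t₀) :=
      ContinuousAt.comp (g := G) (x := ((0 : ℝ), t₀))
        (f := fun q : ℝ × (Fin (k + 1) → ℂ) => ((0 : ℝ), q.2)) hG (by fun_prop)
    exact ((h0.prodMk hG).tendsto.mono_left hle).mono_right (nhds_le_uniformity (G (0, t₀)))
  have hpos : ∀ᶠ q : ℝ × (Fin (k + 1) → ℂ) in
      𝓝[>] (0 : ℝ) ×ˢ 𝓝[{t : Fin (k + 1) → ℂ | ∀ i, t i ≠ 0}] t₀, 0 < q.1 :=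
    tendsto_fst.eventually self_mem_nhdsWithin
  refine hpair.congr' ?_
  filter_upwards [hle hgood, hpos] with q hq hq0
  rw [hG0 q.2 fun i => (hq i).1]
  exact congrArg _ (okuyamaCurve_corr_eq_localCorr hq0 h1 hq)

theorem deriv_affine (l : ℂ) (s : ℂ) : deriv (fun s : ℂ => l * s + 1) s = l := by
  simp

end

theorem proposition3p7 (g n : ℕ) (hn : 1 ≤ n) (hstable : 2 < 2 * g + n) :
    (∀ q : ℝ, 0 < q → q < 1 → ∀ z : Fin n → ℂ, (∀ i, z i ≠ 1 ∧ z i ≠ -1) →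
      Tendsto (fun M : ℕ => (okuyamaCurveTrunc q M).corr g n z) atTop
        (𝓝 ((okuyamaCurve q).corr g n z))) ∧
    (∀ᶠ M : ℕ in atTop, ∀ t : Fin n → ℂ, (∀ i, t i ≠ 0) →
      (wpCurveTrunc M).corr g n t = wpCurve.corr g n t) ∧
    TendstoLocallyUniformlyOn
      (fun (l : ℝ) (t : Fin n → ℂ) =>
        (l : ℂ) ^ (6 * (g : ℤ) - 6 + 3 * (n : ℤ)) *
          pullbackCoeff (fun s : ℂ => (l : ℂ) * s + 1)
            ((okuyamaCurve (Real.exp (-l))).corr g n) t)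
      (fun t : Fin n → ℂ => (2 : ℂ) ^ (2 - 2 * (g : ℤ) - (n : ℤ)) * wpCurve.corr g n t)
      (𝓝[>] (0 : ℝ)) {t : Fin n → ℂ | ∀ i, t i ≠ 0} := by
  obtain ⟨k, rfl⟩ : ∃ k, n = k + 1 := ⟨n - 1, by omega⟩
  have h2 : 2 ≤ 2 * g + k := by omega
  refine ⟨fun q hq0 hq1 z hz => tendsto_okuyamaCurveTrunc_corr hq0 hq1 h2 hz,
    eventually_wpCurveTrunc_corr_eq (by omega), ?_⟩
  obtain ⟨χ, hχ⟩ : ∃ χ, 2 * g + k = χ + 1 := ⟨2 * g + k - 1, by omega⟩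
  have key := tendstoLocallyUniformlyOn_okuyamaCurve_corr h2
  have e1 : (6 * (g : ℤ) - 6 + 3 * ((k + 1 : ℕ) : ℤ)) = ((3 * χ : ℕ) : ℤ) := by omega
  have e2 : (2 - 2 * (g : ℤ) - ((k + 1 : ℕ) : ℤ)) = -((χ : ℕ) : ℤ) := by omega
  rw [hχ, Nat.add_sub_cancel] at key
  rw [e1, e2]
  simp only [pullbackCoeff, deriv_affine, Finset.prod_const, Finset.card_univ, Fintype.card_fin,
    zpow_natCast, zpow_neg]
  convert! key using 3
  · rw [pow_mul]
    ring
  · rw [one_div, inv_pow]
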